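/- Let $\Gamma\subset SL(2,\mathbb Z)$ be a subgroup of finite index, $P\Gamma$ its image in $PSL(2,\mathbb Z)$, $H$ the complex upper half plane and $\overline H=H\cup\mathbb P^1(\mathbb Q)$. Let $(k_i)$ be a finite family of pairwise distinct integers $k_i\ge 2$. Let $Sh_{k}$ be the space of $1$-forms on $H$ spanned by the forms $f(z)P(z,1)\,dz$, where $f$ is a cusp form of weight $k$ for $\Gamma$ and $P(X,Y)$ is a complex homogeneous polynomial of degree $k-2$; put $Sh=\bigoplus_i Sh_{k_i}$. The group $P\Gamma$ acts on $Sh$ by pullback $g^*$, and on the dual space $Sh^*$ from the left by $(g_*\nu)(\omega)=\nu(g^*\omega)$. Let $(\omega_v)_{v\in V}$ be a basis of $Sh$, $(A_v)$ the dual basis, and $\mathbb C\langle\langle A_v\rangle\rangle$ the ring of formal series in the associative noncommuting variables $A_v$, with the continuous comultiplication given by $\Delta(A_v)=A_v\otimes 1+1\otimes A_v$. Let $\Pi$ be the multiplicative group of group-like series, i.e. of those $F$ with $\Delta(F)=F\otimes F$ and constant term $1$; $P\Gamma$ acts on $\Pi$ from the left through the ring automorphisms induced by $g_*$. Put $\Omega=\sum_v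 A_v\omega_v$ and, for $a,z\in\overline H$, $$J_a^z(\Omega)=1+\sum_{n\ge 1}\int_a^z\Omega(z_1)\int_a^{z_1}\Omega(z_2)\cdots\int_a^{z_{n-1}}\Omega(z_n).$$ For a group $G$ acting on a group $N$ by automorphisms, $Z^1(G,N)$ is the set of maps $u:G\to N$ with $u(g_1g_2)=u(g_1)\cdot g_1u(g_2)$, and $H^1(G,N)$ is its quotient by the relation: $u'\sim u$ if there is $n\in N$ with $u'(g)=n^{-1}u(g)\,gn$ for all $g$. The trivial class is that of the constant cocycle $1$. Then the integrals defining the coefficients of $J_a^z(\Omega)$ converge absolutely, and: (i) For every $a\in\overline H$ the map $\gamma\mapsto J^a_{\gamma a}(\Omega)$ takes values in $\Pi$ and is a noncommutative $1$-cocycle, an element of $Z^1(P\Gamma,\Pi)$. (ii) The cohomology class of this cocycle in $H^1(P\Gamma,\Pi)$ does not depend on $a\in\overline H$. (iii) This class is cuspidal: for every cusp $c\in\mathbb P^1(\mathbb Q)$ its restriction to the stabilizer of $c$ in $P\Gamma$ is trivial. -/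

import Mathlib

open scoped MatrixGroups
open UpperHalfPlane

/-! ## Noncommutative group cohomology in degree one -/

namespace NonabCohomology

/-- `Z¹(G, N)`: maps `u : G → N` with `u (g₁ g₂) = u g₁ · g₁ (u g₂)`. -/
def Z1 (G N : Type*) [Group G] [Group N] [MulDistribMulAction G N] : Type _ :=
  {u : G → N // ∀ g₁ g₂ : G, u (g₁ * g₂) = u g₁ * g₁ • u g₂}

variable {G N : Type*} [Group G] [Group N] [MulDistribMulAction G N]

/-- `u'` and `u` are cohomologous iff `u' g = n⁻¹ · u g · g n` for some `n`. -/
def cohomologous (u u' : Z1 G N) : Prop :=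
  ∃ n : N, ∀ g : G, u'.1 g = n⁻¹ * u.1 g * g • n

theorem cohomologous_equivalence : Equivalence (cohomologous (G := G) (N := N)) where
  refl u := ⟨1, fun g => by simp⟩
  symm := by
    rintro u u' ⟨n, hn⟩
    exact ⟨n⁻¹, fun g => by rw [hn g, smul_inv']; group⟩
  trans := by
    rintro u u' u'' ⟨n, hn⟩ ⟨m, hm⟩
    exact ⟨n * m, fun g => by rw [hm g, hn g, smul_mul']; group⟩

variable (G N) in
/-- Cohomology of cocycles as a setoid. -/
def cohomologySetoid : Setoid (Z1 G N) := ⟨cohomologous, cohomologous_equivalence⟩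

variable (G N) in
/-- The pointed set `H¹(G, N)`. -/
def H1 : Type _ := Quotient (cohomologySetoid G N)

/-- The class of a cocycle. -/
def H1.mk (u : Z1 G N) : H1 G N := Quotient.mk (cohomologySetoid G N) u

variable (G N) in
/-- The cocycle with constant value `1`. -/
def Z1.one : Z1 G N := ⟨fun _ => 1, fun _ _ => by simp⟩

variable (G N) in
/-- The marked point of `H¹(G, N)`. -/
def H1.trivial : H1 G N := H1.mk (Z1.one G N)

/-- Restriction of a cocycle to a subgroup. -/
def Z1.res (S : Subgroup G) (u : Z1 G N) : Z1 S N :=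
  ⟨fun g => u.1 g, fun g₁ g₂ => u.2 g₁ g₂⟩

/-- Restriction of a cohomology class to a subgroup. -/
def H1.res (S : Subgroup G) : H1 G N → H1 S N :=
  Quotient.map' (Z1.res S) (by
    rintro u u' ⟨n, hn⟩
    exact ⟨n, fun g => hn g⟩)

end NonabCohomology

/-! ## Formal series in associative noncommuting variables -/

/-- The ring `R⟨⟨A_v | v ∈ V⟩⟩`; `F w` is the coefficient of the word `A_{w₁} A_{w₂} ⋯`.
Scalars commute with the variables. -/
def NCSeries (V R : Type*) : Type _ := List V → R

namespace NCSeries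

variable {V R : Type*}

@[ext] theorem ext {F G : NCSeries V R} (h : ∀ w, F w = G w) : F = G := funext h

/-- The series `F_a` with `F = F(∅) + ∑_a A_a F_a`. -/
def tail (a : V) (F : NCSeries V R) : NCSeries V R := fun w => F (a :: w)

theorem tail_apply (a : V) (F : NCSeries V R) (w : List V) : tail a F w = F (a :: w) := rfl

section Ring

variable [Ring R]

instance : AddCommGroup (NCSeries V R) := inferInstanceAs (AddCommGroup (List V → R))

instance : One (NCSeries V R) := ⟨fun w => match w with | [] => 1 | _ :: _ => 0⟩

instance : Mul (NCSeries V R) :=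
  ⟨fun F G w => ∑ i ∈ Finset.range (w.length + 1), F (w.take i) * G (w.drop i)⟩

theorem one_nil : (1 : NCSeries V R) [] = 1 := rfl
theorem one_cons (a : V) (w : List V) : (1 : NCSeries V R) (a :: w) = 0 := rfl
theorem add_apply (F G : NCSeries V R) (w : List V) : (F + G) w = F w + G w := rfl
theorem zero_apply (w : List V) : (0 : NCSeries V R) w = 0 := rfl

theorem mul_apply (F G : NCSeries V R) (w : List V) :
    (F * G) w = ∑ i ∈ Finset.range (w.length + 1), F (w.take i) * G (w.drop i) := rfl

theorem mul_nil (F G : NCSeries V R) : (F * G) [] = F [] * G [] := by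
  simp [mul_apply]

theorem mul_cons (F G : NCSeries V R) (a : V) (w : List V) :
    (F * G) (a :: w) = F [] * G (a :: w) + (tail a F * G) w := by
  simp only [mul_apply, List.length_cons]
  rw [Finset.sum_range_succ']
  simp [tail_apply, add_comm]

instance : Ring (NCSeries V R) :=
  { (inferInstance : AddCommGroup (NCSeries V R)) with
    one := 1
    mul := (· * ·)
    one_mul := fun F => by
      ext w
      cases w with
      | nil => simp [mul_nil, one_nil]
      | cons a w =>
        have : tail a (1 : NCSeries V R) = 0 := rfl
        have h0 : ((0 : NCSeries V R) * F) w = 0 := by simp [mul_apply, zero_apply]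
        change (1 * F : NCSeries V R) (a :: w) = F (a :: w)
        rw [mul_cons, one_nil, this, h0, one_mul, add_zero]
    mul_one := fun F => by
      ext w
      induction w generalizing F with
      | nil => simp [mul_nil, one_nil]
      | cons a w ih => simp [mul_cons, one_cons, ih, tail_apply]
    left_distrib := fun F G H => by
      ext w; simp [mul_apply, add_apply, mul_add, Finset.sum_add_distrib]
    right_distrib := fun F G H => by
      ext w; simp [mul_apply, add_apply, add_mul, Finset.sum_add_distrib]
    zero_mul := fun F => by ext w; simp [mul_apply, zero_apply]
    mul_zero := fun F => by ext w; simp [mul_apply, zero_apply]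
    mul_assoc := fun F G H => by
      ext w
      induction w generalizing F G H with
      | nil => simp [mul_nil, mul_assoc]
      | cons a w ih =>
        let K : NCSeries V R := fun u => F [] * tail a G u
        have h : tail a (F * G) = K + tail a F * G := by
          ext u; rw [add_apply]; simp only [K, tail_apply, mul_cons]
        have h2 : ∀ X Y Z : NCSeries V R, ((X + Y) * Z) w = (X * Z) w + (Y * Z) w := by
          intro X Y Z; simp [mul_apply, add_apply, add_mul, Finset.sum_add_distrib]
        have h3 : (K * H) w = F [] * (tail a G * H) w := by
          rw [mul_apply, mul_apply, Finset.mul_sum]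
          exact Finset.sum_congr rfl fun i _ => mul_assoc _ _ _
        simp only [mul_cons, mul_nil, h, h2, h3, ih]
        rw [mul_add, mul_assoc, add_assoc] }

end Ring

/-- All shuffles of two words, with multiplicity. -/
def shuffles : List V → List V → List (List V)
  | [], v => [v]
  | u, [] => [u]
  | a :: u, b :: v =>
    (shuffles u (b :: v)).map (a :: ·) ++ (shuffles (a :: u) v).map (b :: ·)
termination_by u v => u.length + v.length

theorem shuffles_nil_left (v : List V) : shuffles [] v = [v] := by
  cases v <;> simp [shuffles]
theorem shuffles_nil_right (u : List V) : shuffles u [] = [u] := by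
  cases u <;> simp [shuffles]
theorem shuffles_cons (a b : V) (u v : List V) : shuffles (a :: u) (b :: v) =
    (shuffles u (b :: v)).map (a :: ·) ++ (shuffles (a :: u) v).map (b :: ·) := by
  rw [shuffles]

/-- The completed tensor square of `ℂ⟨⟨A_v⟩⟩`, as series in the `A_v ⊗ 1` whose coefficients are
series in the `1 ⊗ A_v`; the coefficient of `u ⊗ v` in `T` is `T u v`. -/
abbrev Square (V : Type*) : Type _ := NCSeries V (NCSeries V ℂ)

/-- `F ⊗ G` in the completed tensor square. -/
def tmul (F G : NCSeries V ℂ) : Square V := fun u v => F u * G v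

/-- The comultiplication. A word `w` is sent to the sum of `w|_S ⊗ w|_{Sᶜ}` over all sets `S` of
positions, so `u ⊗ v` occurs in `Δ F` with the sum of the coefficients of `F` at all shuffles of
`u` and `v`. It is the continuous algebra map with `Δ A_v = A_v ⊗ 1 + 1 ⊗ A_v`
(see `comul_one`, `comul_mul`, `comul_X`). -/
def comul (F : NCSeries V ℂ) : Square V := fun u v => ((shuffles u v).map fun w => F w).sum

/-- The variable `A_v`. -/
def X [DecidableEq V] (v : V) : NCSeries V ℂ := fun w => if w = [v] then 1 else 0

theorem comul_nil_left (F : NCSeries V ℂ) (v : List V) : comul F [] v = F v := by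
  simp [comul, shuffles_nil_left]
theorem comul_nil_right (F : NCSeries V ℂ) (u : List V) : comul F u [] = F u := by
  simp [comul, shuffles_nil_right]
theorem comul_cons (F : NCSeries V ℂ) (a b : V) (u v : List V) :
    comul F (a :: u) (b :: v) = comul (tail a F) u (b :: v) + comul (tail b F) (a :: u) v := by
  simp [comul, shuffles_cons, Function.comp_def, tail_apply]

theorem comul_lin (c : ℂ) (F G : NCSeries V ℂ) (u v : List V) :
    comul (fun w => c * F w + G w : NCSeries V ℂ) u v = c * comul F u v + comul G u v := by
  simp only [comul]
  induction shuffles u v with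
  | nil => simp
  | cons w l ih => simp only [List.map_cons, List.sum_cons, ih]; ring

theorem comul_one : comul (1 : NCSeries V ℂ) = 1 := by
  ext u v
  induction u generalizing v with
  | nil => cases v <;> rw [comul_nil_left] <;> rfl
  | cons a u ih =>
    have h : ∀ x u v, comul (tail x (1 : NCSeries V ℂ)) u v = 0 := by
      intro x u v
      simp only [comul]
      induction shuffles u v with
      | nil => simp
      | cons w l ih => rw [List.map_cons, List.sum_cons, ih]; simp [tail_apply, one_cons]
    cases v with
    | nil => rw [comul_nil_right]; rfl
    | cons b v => rw [comul_cons, h, h]; simp [one_cons, zero_apply]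

theorem comul_X [DecidableEq V] (x : V) : comul (X x) = tmul (X x) 1 + tmul 1 (X x) := by
  ext u v
  have h : ∀ a u v, comul (tail a (X x)) u v = if a = x ∧ u = [] ∧ v = [] then 1 else 0 := by
    intro a u v
    have e : tail a (X x) = (fun w => (if a = x then 1 else 0) * (1 : NCSeries V ℂ) w
        + (0 : NCSeries V ℂ) w : NCSeries V ℂ) := by
      ext w
      cases w <;> simp [tail_apply, X, one_nil, one_cons, zero_apply]
    have z : comul (0 : NCSeries V ℂ) u v = 0 := by
      simp only [comul]
      induction shuffles u v with
      | nil => simp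
      | cons w l ih => rw [List.map_cons, List.sum_cons, ih]; simp [zero_apply]
    rw [e, comul_lin, z, comul_one]
    cases u <;> cases v <;> simp [one_nil, one_cons, zero_apply]
  simp only [add_apply, tmul]
  cases u with
  | nil => cases v <;> simp [comul_nil_left, one_nil, one_cons, X]
  | cons a u =>
    cases v with
    | nil => simp [comul_nil_right, one_nil, one_cons, X]
    | cons b v => simp [comul_cons, h, one_cons]

theorem sum_apply {ι : Type*} (s : Finset ι) (f : ι → NCSeries V ℂ) (v : List V) :
    (∑ i ∈ s, f i) v = ∑ i ∈ s, f i v := by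
  classical
  induction s using Finset.induction_on with
  | empty => simp [zero_apply]
  | insert a s ha ih => rw [Finset.sum_insert ha, Finset.sum_insert ha, add_apply, ih]

theorem square_mul_apply (S T : Square V) (u v : List V) : (S * T) u v =
    ∑ i ∈ Finset.range (u.length + 1), ∑ j ∈ Finset.range (v.length + 1),
      S (u.take i) (v.take j) * T (u.drop i) (v.drop j) := by
  rw [mul_apply, sum_apply]
  rfl

theorem comul_mul (F G : NCSeries V ℂ) : comul (F * G) = comul F * comul G := by
  have ht : ∀ (F G : NCSeries V ℂ) (a : V), tail a (F * G)
      = (fun w => F [] * tail a G w + (tail a F * G) w : NCSeries V ℂ) := by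
    intro F G a; ext w; simp [tail_apply, mul_cons]
  have key : ∀ (n : ℕ) (F G : NCSeries V ℂ) (u v : List V), u.length + v.length = n →
      comul (F * G) u v = (comul F * comul G) u v := by
    intro n
    induction n with
    | zero =>
      intro F G u v h
      have hu : u = [] := List.length_eq_zero_iff.mp (by omega)
      have hv : v = [] := List.length_eq_zero_iff.mp (by omega)
      subst hu hv
      simp [square_mul_apply, comul_nil_left, mul_nil]
    | succ n ih =>
      intro F G u v h
      cases u with
      | nil => simp [square_mul_apply, comul_nil_left, mul_apply]
      | cons a u =>
        cases v with
        | nil => simp [square_mul_apply, comul_nil_right, mul_apply]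
        | cons b v =>
          rw [comul_cons, ht, ht, comul_lin, comul_lin,
            ih _ _ u (b :: v) (by simp at h ⊢; omega),
            ih _ _ (a :: u) v (by simp at h ⊢; omega)]
          simp only [square_mul_apply, List.length_cons]
          rw [Finset.sum_range_succ' _ (u.length + 1)]
          simp only [Finset.sum_range_succ' _ (v.length + 1), List.take_succ_cons,
            List.drop_succ_cons, List.take_zero, List.drop_zero]
          rw [Finset.sum_range_succ' _ (u.length + 1)]
          simp only [List.take_succ_cons, List.drop_succ_cons, List.take_zero, List.drop_zero,
            comul_cons, comul_nil_left, comul_nil_right, add_mul, Finset.sum_add_distrib,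
            tail_apply]
          ring
  ext u v
  exact key _ F G u v rfl

theorem tmul_mul (F F' G G' : NCSeries V ℂ) :
    tmul (F * F') (G * G') = tmul F G * tmul F' G' := by
  ext u v
  simp only [square_mul_apply, tmul, mul_apply, Finset.sum_mul_sum]
  refine Finset.sum_congr rfl fun i _ => Finset.sum_congr rfl fun j _ => by ring

theorem tmul_one : tmul (1 : NCSeries V ℂ) 1 = 1 := by
  ext u v
  cases u <;> simp [tmul, one_nil, one_cons, zero_apply]

/-- `F` is group-like: `Δ F = F ⊗ F` and `F ≡ 1 mod (A_v)`. -/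
def IsGroupLike (F : NCSeries V ℂ) : Prop := comul F = tmul F F ∧ F [] = 1

variable (V) in
/-- The multiplicative group of group-like series. -/
def groupLike : Subgroup (NCSeries V ℂ)ˣ where
  carrier := {F | IsGroupLike (F : NCSeries V ℂ)}
  one_mem' := ⟨by simp [comul_one, tmul_one], rfl⟩
  mul_mem' := by
    rintro F G ⟨hF, hF1⟩ ⟨hG, hG1⟩
    exact ⟨by simp [comul_mul, tmul_mul, hF, hG], by simp [mul_nil, hF1, hG1]⟩
  inv_mem' := by
    rintro F ⟨hF, hF1⟩
    have h1 : comul (F⁻¹ : (NCSeries V ℂ)ˣ).1 * comul F.1 = 1 := by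
      rw [← comul_mul, Units.inv_mul, comul_one]
    have h2 : comul F.1 * tmul (F⁻¹ : (NCSeries V ℂ)ˣ).1 (F⁻¹ : (NCSeries V ℂ)ˣ).1 = 1 := by
      rw [hF, ← tmul_mul, Units.mul_inv, tmul_one]
    refine ⟨left_inv_eq_right_inv h1 h2, ?_⟩
    have := congrArg (fun X : NCSeries V ℂ => X []) (Units.inv_mul F)
    simpa [mul_nil, hF1, one_nil] using this

/-! ### Linear substitutions of the variables

Let `W` have the basis `(ω_v)` and let `A_v` be the dual basis vectors. A series is a sequence of
multilinear functionals on `W`, the word `A_{v₁} ⋯ A_{vₙ}` being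
`(x₁, …, xₙ) ↦ ∏ A_{vᵢ}(xᵢ)`. -/

section Subst

variable {W : Type*} [AddCommGroup W] [Module ℂ W] (ω : Module.Basis V ℂ W)

/-- Contraction of the first tensor factor of `F` with `x ∈ W`. -/
noncomputable def contract (x : W) (F : NCSeries V ℂ) : NCSeries V ℂ :=
  fun w => ω.constr ℂ (fun v => F (v :: w)) x

/-- The value of `F` at a list of vectors. -/
noncomputable def evalList (F : NCSeries V ℂ) : List W → ℂ
  | [] => F []
  | x :: xs => evalList (contract ω x F) xs

/-- The substitution `A_v ↦ A_v ∘ φ` of the variables, extended to series: the coefficient at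
`A_{v₁} ⋯ A_{vₙ}` of the new series is the value of `F` at `(φ ω_{v₁}, …, φ ω_{vₙ})`. -/
noncomputable def subst (φ : W →ₗ[ℂ] W) (F : NCSeries V ℂ) : NCSeries V ℂ :=
  fun w => evalList ω F (w.map fun v => φ (ω v))

theorem contract_add (x y : W) (F : NCSeries V ℂ) :
    contract ω (x + y) F = contract ω x F + contract ω y F := by
  ext w; simp [contract, add_apply]

theorem contract_smul (c : ℂ) (x : W) (F : NCSeries V ℂ) :
    contract ω (c • x) F = fun w => c * contract ω x F w := by
  ext w; simp [contract]

theorem contract_basis (v : V) (F : NCSeries V ℂ) : contract ω (ω v) F = tail v F := by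
  ext w; simp [contract, tail_apply]

/-- Two linear expressions agree if they agree on the basis. -/
theorem lin_ext {f g : W → ℂ} (hf : IsLinearMap ℂ f) (hg : IsLinearMap ℂ g)
    (h : ∀ v, f (ω v) = g (ω v)) (x : W) : f x = g x := by
  have : hf.mk' f = hg.mk' g := ω.ext h
  exact LinearMap.congr_fun this x

theorem contract_lin (x : W) (c : ℂ) (F G : NCSeries V ℂ) :
    contract ω x (fun w => c * F w + G w : NCSeries V ℂ)
      = fun w => c * contract ω x F w + contract ω x G w := by
  ext w
  refine lin_ext ω (f := fun x => contract ω x (fun w => c * F w + G w : NCSeries V ℂ) w)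
    (g := fun x => c * contract ω x F w + contract ω x G w) ?_ ?_ ?_ x
  · exact ⟨fun x y => by simp [contract], fun d x => by simp [contract]⟩
  · exact ⟨fun x y => by simp [contract]; ring, fun d x => by simp [contract]; ring⟩
  · intro v; simp [contract]

theorem evalList_lin (c : ℂ) (F G : NCSeries V ℂ) (xs : List W) :
    evalList ω (fun w => c * F w + G w : NCSeries V ℂ) xs
      = c * evalList ω F xs + evalList ω G xs := by
  induction xs generalizing F G with
  | nil => rfl
  | cons x xs ih => simp only [evalList, contract_lin, ih]

theorem evalList_add (F G : NCSeries V ℂ) (xs : List W) :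
    evalList ω (F + G) xs = evalList ω F xs + evalList ω G xs := by
  have := evalList_lin ω 1 F G xs
  simp only [one_mul] at this
  exact this

theorem evalList_zero (xs : List W) : evalList ω (0 : NCSeries V ℂ) xs = 0 := by
  have := evalList_add ω (0 : NCSeries V ℂ) 0 xs
  simpa using this

theorem evalList_smul (c : ℂ) (F : NCSeries V ℂ) (xs : List W) :
    evalList ω (fun w => c * F w : NCSeries V ℂ) xs = c * evalList ω F xs := by
  have := evalList_lin ω c F 0 xs
  simpa [zero_apply, evalList_zero] using this

theorem evalList_isLinear_slot (F : NCSeries V ℂ) (p q : List W) :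
    IsLinearMap ℂ fun x => evalList ω F (p ++ x :: q) := by
  induction p generalizing F with
  | nil =>
    constructor
    · intro x y; simp [evalList, contract_add, evalList_add]
    · intro c x; simp [evalList, contract_smul, evalList_smul]
  | cons y p ih => simpa [evalList] using ih (contract ω y F)

theorem evalList_basis (F : NCSeries V ℂ) (w : List V) : evalList ω F (w.map ω) = F w := by
  induction w generalizing F with
  | nil => rfl
  | cons a w ih => simp [evalList, contract_basis, ih, tail_apply]

/-- A function on lists that is linear in every slot is determined by its values on the basis. -/
theorem eq_zero_of_slots {φ : List W → ℂ}
    (hφ : ∀ p q, IsLinearMap ℂ fun x => φ (p ++ x :: q))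
    (h : ∀ w : List V, φ (w.map ω) = 0) (xs : List W) : φ xs = 0 := by
  have key : ∀ (xs : List W) (w : List V), φ (w.map ω ++ xs) = 0 := by
    intro xs
    induction xs with
    | nil => intro w; simpa using h w
    | cons x xs ih =>
      intro w
      refine lin_ext ω (g := fun _ => 0) (hφ (w.map ω) xs) ⟨by simp, by simp⟩ ?_ x
      intro v
      simpa using ih (w ++ [v])
  simpa using key xs []

theorem evalList_subst (φ : W →ₗ[ℂ] W) (F : NCSeries V ℂ) (xs : List W) :
    evalList ω (subst ω φ F) xs = evalList ω F (xs.map φ) := by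
  have := eq_zero_of_slots ω
    (φ := fun xs => evalList ω (subst ω φ F) xs - evalList ω F (xs.map φ)) ?_ ?_ xs
  · exact sub_eq_zero.mp this
  · intro p q
    have h1 := evalList_isLinear_slot ω (subst ω φ F) p q
    have h2 := evalList_isLinear_slot ω F (p.map φ) (q.map φ)
    constructor
    · intro x y
      have := h2.map_add (φ x) (φ y)
      simp only [List.map_append, List.map_cons, map_add, h1.map_add] at this ⊢
      rw [this]; ring
    · intro c x
      have := h2.map_smul c (φ x)
      simp only [List.map_append, List.map_cons, map_smul, h1.map_smul, smul_eq_mul] at this ⊢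
      rw [this]; ring
  · intro w
    simp only [evalList_basis, subst, List.map_map]
    exact sub_eq_zero.mpr rfl

theorem subst_subst (φ ψ : W →ₗ[ℂ] W) (F : NCSeries V ℂ) :
    subst ω φ (subst ω ψ F) = subst ω (ψ ∘ₗ φ) F := by
  ext w
  change evalList ω (subst ω ψ F) _ = _
  rw [evalList_subst, List.map_map]
  rfl

theorem subst_id (F : NCSeries V ℂ) : subst ω LinearMap.id F = F := by
  ext w
  exact evalList_basis ω F w

theorem contract_mul (x : W) (F G : NCSeries V ℂ) : contract ω x (F * G)
    = fun w => F [] * contract ω x G w + (contract ω x F * G) w := by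
  ext w
  refine lin_ext ω (f := fun x => contract ω x (F * G) w)
    (g := fun x => F [] * contract ω x G w + (contract ω x F * G) w) ?_ ?_ ?_ x
  · exact ⟨fun x y => by simp [contract], fun d x => by simp [contract]⟩
  · constructor
    · intro x y
      simp only [contract_add, add_apply, add_mul]; ring
    · intro c x
      simp only [contract_smul, mul_apply, smul_eq_mul, mul_add, Finset.mul_sum]
      congr 1
      · ring
      · exact Finset.sum_congr rfl fun i _ => by ring
  · intro v
    simp only [contract_basis]
    simp [tail_apply, mul_cons]

theorem evalList_mul (F G : NCSeries V ℂ) (xs : List W) : evalList ω (F * G) xs =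
    ∑ i ∈ Finset.range (xs.length + 1), evalList ω F (xs.take i) * evalList ω G (xs.drop i) := by
  induction xs generalizing F G with
  | nil => simp [evalList, mul_nil]
  | cons x xs ih =>
    rw [List.length_cons, Finset.sum_range_succ']
    simp only [evalList, contract_mul, evalList_lin, List.take_succ_cons, List.drop_succ_cons,
      List.take_zero, List.drop_zero, ih]
    ring

theorem subst_mul (φ : W →ₗ[ℂ] W) (F G : NCSeries V ℂ) :
    subst ω φ (F * G) = subst ω φ F * subst ω φ G := by
  ext w
  simp only [subst, evalList_mul, mul_apply, List.length_map, List.map_take, List.map_drop]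

theorem subst_one (φ : W →ₗ[ℂ] W) : subst ω φ 1 = 1 := by
  ext w
  cases w with
  | nil => rfl
  | cons a w =>
    have : contract ω (φ (ω a)) (1 : NCSeries V ℂ) = 0 := by
      ext u
      refine lin_ext ω (f := fun x => contract ω x 1 u) (g := fun _ => 0)
        ⟨fun x y => by simp [contract], fun d x => by simp [contract]⟩ ⟨by simp, by simp⟩ ?_ _
      intro v; simp [contract_basis, tail_apply, one_cons]
    simp only [subst, List.map_cons, evalList, this, evalList_zero, one_cons]

/-- The sum of the values of `F` at all shuffles of two lists of vectors. -/
noncomputable def shuffleEval (F : NCSeries V ℂ) (xs ys : List W) : ℂ :=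
  ((shuffles xs ys).map fun zs => evalList ω F zs).sum

theorem shuffleEval_cons (F : NCSeries V ℂ) (x y : W) (xs ys : List W) :
    shuffleEval ω F (x :: xs) (y :: ys) = shuffleEval ω (contract ω x F) xs (y :: ys)
      + shuffleEval ω (contract ω y F) (x :: xs) ys := by
  simp [shuffleEval, shuffles_cons, Function.comp_def, evalList]

theorem shuffleEval_nil_left (F : NCSeries V ℂ) (ys : List W) :
    shuffleEval ω F [] ys = evalList ω F ys := by simp [shuffleEval, shuffles_nil_left]
theorem shuffleEval_nil_right (F : NCSeries V ℂ) (xs : List W) :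
    shuffleEval ω F xs [] = evalList ω F xs := by simp [shuffleEval, shuffles_nil_right]

theorem shuffleEval_add (F G : NCSeries V ℂ) (xs ys : List W) :
    shuffleEval ω (F + G) xs ys = shuffleEval ω F xs ys + shuffleEval ω G xs ys := by
  simp only [shuffleEval]
  induction shuffles xs ys with
  | nil => simp
  | cons w l ih => rw [List.map_cons, List.sum_cons, ih, evalList_add]; simp only [List.map_cons, List.sum_cons]; ring

theorem shuffleEval_smul (c : ℂ) (F : NCSeries V ℂ) (xs ys : List W) :
    shuffleEval ω (fun w => c * F w : NCSeries V ℂ) xs ys = c * shuffleEval ω F xs ys := by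
  simp only [shuffleEval]
  induction shuffles xs ys with
  | nil => simp
  | cons w l ih => rw [List.map_cons, List.sum_cons, ih, evalList_smul]; simp only [List.map_cons, List.sum_cons]; ring

theorem isLinear_add {f g : W → ℂ} (hf : IsLinearMap ℂ f) (hg : IsLinearMap ℂ g) :
    IsLinearMap ℂ fun x => f x + g x :=
  (hf.mk' f + hg.mk' g).isLinear

theorem shuffleEval_slot_left (n : ℕ) (F : NCSeries V ℂ) (p q ys : List W)
    (hn : p.length + ys.length = n) :
    IsLinearMap ℂ fun x => shuffleEval ω F (p ++ x :: q) ys := by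
  induction n generalizing F p ys with
  | zero =>
    have hy : ys = [] := List.length_eq_zero_iff.mp (by omega)
    subst hy
    simpa [shuffleEval_nil_right] using evalList_isLinear_slot ω F p q
  | succ n ih =>
    cases ys with
    | nil => simpa [shuffleEval_nil_right] using evalList_isLinear_slot ω F p q
    | cons y ys =>
      cases p with
      | nil =>
        simp only [List.nil_append, shuffleEval_cons]
        refine isLinear_add ⟨?_, ?_⟩ ?_
        · intro a b; simp [contract_add, shuffleEval_add]
        · intro c a; simp [contract_smul, shuffleEval_smul]
        · exact ih (contract ω y F) [] ys (by simp at hn ⊢; omega)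
      | cons z p =>
        simp only [List.cons_append, shuffleEval_cons]
        refine isLinear_add ?_ ?_
        · exact ih (contract ω z F) p (y :: ys) (by simp at hn ⊢; omega)
        · exact ih (contract ω y F) (z :: p) ys (by simp at hn ⊢; omega)

theorem shuffleEval_comm (n : ℕ) (F : NCSeries V ℂ) (xs ys : List W)
    (hn : xs.length + ys.length = n) : shuffleEval ω F xs ys = shuffleEval ω F ys xs := by
  induction n generalizing F xs ys with
  | zero =>
    have hx : xs = [] := List.length_eq_zero_iff.mp (by omega)
    have hy : ys = [] := List.length_eq_zero_iff.mp (by omega)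
    subst hx hy; rfl
  | succ n ih =>
    cases xs with
    | nil => rw [shuffleEval_nil_left, shuffleEval_nil_right]
    | cons x xs =>
      cases ys with
      | nil => rw [shuffleEval_nil_left, shuffleEval_nil_right]
      | cons y ys =>
        rw [shuffleEval_cons, shuffleEval_cons,
          ih _ xs (y :: ys) (by simp at hn ⊢; omega),
          ih _ (x :: xs) ys (by simp at hn ⊢; omega), add_comm]

theorem shuffles_map {A B : Type*} (f : A → B) (n : ℕ) (u v : List A)
    (hn : u.length + v.length = n) :
    shuffles (u.map f) (v.map f) = (shuffles u v).map (List.map f) := by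
  induction n generalizing u v with
  | zero =>
    have hx : u = [] := List.length_eq_zero_iff.mp (by omega)
    have hy : v = [] := List.length_eq_zero_iff.mp (by omega)
    subst hx hy; simp [shuffles_nil_left]
  | succ n ih =>
    cases u with
    | nil => simp [shuffles_nil_left]
    | cons a u =>
      cases v with
      | nil => simp [shuffles_nil_right]
      | cons b v =>
        have h1 := ih u (b :: v) (by simp at hn ⊢; omega)
        have h2 := ih (a :: u) v (by simp at hn ⊢; omega)
        simp only [List.map_cons] at h1 h2
        simp only [List.map_cons, shuffles_cons, h1, h2, List.map_append, List.map_map]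
        rfl

theorem shuffleEval_of_isGroupLike {F : NCSeries V ℂ} (hF : IsGroupLike F) (xs ys : List W) :
    shuffleEval ω F xs ys = evalList ω F xs * evalList ω F ys := by
  have step : ∀ (u : List V) (ys : List W),
      shuffleEval ω F (u.map ω) ys - F u * evalList ω F ys = 0 := by
    intro u ys
    refine eq_zero_of_slots ω (φ := fun ys => shuffleEval ω F (u.map ω) ys
      - F u * evalList ω F ys) ?_ ?_ ys
    · intro p q
      have h1 := shuffleEval_slot_left ω _ F p q (u.map ω) rfl
      have h2 := evalList_isLinear_slot ω F p q
      simp only [fun zs => shuffleEval_comm ω _ F (u.map ω) zs rfl]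
      exact (h1.mk' _ - F u • h2.mk' _).isLinear
    · intro v
      have := congrFun (congrFun hF.1 u) v
      simp only [comul, tmul] at this
      rw [evalList_basis, ← this, shuffleEval, shuffles_map ω _ u v rfl, List.map_map, sub_eq_zero]
      congr 1
      exact List.map_congr_left fun w _ => evalList_basis ω F w
  refine sub_eq_zero.mp (eq_zero_of_slots ω (φ := fun xs => shuffleEval ω F xs ys
    - evalList ω F xs * evalList ω F ys) ?_ ?_ xs)
  · intro p q
    have h1 := shuffleEval_slot_left ω _ F p q ys rfl
    have h2 := evalList_isLinear_slot ω F p q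
    simp only [mul_comm _ (evalList ω F ys)]
    exact (h1.mk' _ - evalList ω F ys • h2.mk' _).isLinear
  · intro u
    simpa [evalList_basis] using step u ys

theorem subst_isGroupLike (φ : W →ₗ[ℂ] W) {F : NCSeries V ℂ} (hF : IsGroupLike F) :
    IsGroupLike (subst ω φ F) := by
  refine ⟨?_, hF.2⟩
  ext u v
  have := shuffleEval_of_isGroupLike ω hF (u.map fun v => φ (ω v)) (v.map fun v => φ (ω v))
  rw [shuffleEval, shuffles_map _ _ u v rfl, List.map_map] at this
  exact this

/-- `subst` as a monoid homomorphism. -/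
noncomputable def substHom (φ : W →ₗ[ℂ] W) : NCSeries V ℂ →* NCSeries V ℂ where
  toFun := subst ω φ
  map_one' := subst_one ω φ
  map_mul' := subst_mul ω φ

/-- `subst` on group-like series. -/
noncomputable def groupLikeSubst (φ : W →ₗ[ℂ] W) : groupLike V →* groupLike V :=
  ((Units.map (substHom ω φ)).comp (groupLike V).subtype).codRestrict _
    fun F => subst_isGroupLike ω φ F.2

end Subst

end NCSeries

/-! ## The modular group, its cusps, and forms of cusp modular type -/

namespace ShimuraCocycle

open Matrix.SpecialLinearGroup

theorem eq_one_or_neg_one_of_mem_center {g : SL(2, ℤ)} (hg : g ∈ Subgroup.center SL(2, ℤ)) :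
    g = 1 ∨ g = -1 := by
  obtain ⟨r, hr, h⟩ := Matrix.SpecialLinearGroup.mem_center_iff.mp hg
  have hr' : r = 1 ∨ r = -1 := by
    simp only [Fintype.card_fin] at hr
    exact sq_eq_one_iff.mp hr
  rcases hr' with rfl | rfl
  · left; ext i j; rw [← h]; simp
  · right; ext i j; rw [← h]; fin_cases i <;> fin_cases j <;> simp

noncomputable instance slRat : MulAction SL(2, ℤ) (OnePoint ℚ) :=
  MulAction.compHom (OnePoint ℚ) (mapGL ℚ)

/-- An action of `SL(2, ℤ)` in which `-1` acts trivially descends to `PSL(2, ℤ)`. -/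
noncomputable abbrev pslAction {X : Type*} [MulAction SL(2, ℤ) X]
    (h : ∀ x : X, (-1 : SL(2, ℤ)) • x = x) : MulAction PSL(2, ℤ) X :=
  MulAction.compHom X (QuotientGroup.lift (Subgroup.center SL(2, ℤ))
    (MulAction.toPermHom SL(2, ℤ) X) (by
      intro g hg
      rw [MonoidHom.mem_ker]
      ext x
      rcases eq_one_or_neg_one_of_mem_center hg with rfl | rfl
      · simp
      · exact h x))

noncomputable instance pslUpperHalfPlane : MulAction PSL(2, ℤ) ℍ :=
  pslAction fun z => by simp

noncomputable instance pslRat : MulAction PSL(2, ℤ) (OnePoint ℚ) :=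
  pslAction fun x => by
    cases x with
    | infty => exact (OnePoint.smul_infty_eq_self_iff).mpr (by simp)
    | coe q =>
      change mapGL ℚ (-1 : SL(2, ℤ)) • (q : OnePoint ℚ) = q
      rw [OnePoint.smul_some_eq_ite]
      simp

theorem mk_smul_upperHalfPlane (g : SL(2, ℤ)) (z : ℍ) : (g : PSL(2, ℤ)) • z = g • z := rfl
theorem mk_smul_rat (g : SL(2, ℤ)) (x : OnePoint ℚ) :
    (g : PSL(2, ℤ)) • x = mapGL ℚ g • x := rfl

/-- `PΓ`, the image of `Γ` in `PSL(2, ℤ)`. -/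
def PGamma (Γ : Subgroup SL(2, ℤ)) : Subgroup PSL(2, ℤ) :=
  Γ.map (QuotientGroup.mk' (Subgroup.center SL(2, ℤ)))

/-- `ℍ ∪ ℙ¹(ℚ)`, with `ℙ¹(ℚ) = ℚ ∪ {∞}`. -/
abbrev Hbar : Type := ℍ ⊕ OnePoint ℚ

/-- Pullback of the one-form `F(z) dz` on `ℍ` along `z ↦ g z`: its coefficient is
`F(g z) · d(g z)/dz`. -/
noncomputable def pullForm (g : PSL(2, ℤ)) : (ℍ → ℂ) →ₗ[ℂ] (ℍ → ℂ) where
  toFun F z := F (g • z) * deriv (fun w : ℂ => ((g • ofComplex w : ℍ) : ℂ)) z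
  map_add' F G := by ext z; simp [add_mul]
  map_smul' c F := by ext z; simp [mul_assoc]

theorem pullForm_mk (g : SL(2, ℤ)) (F : ℍ → ℂ) :
    pullForm (g : PSL(2, ℤ)) F = SlashAction.map (2 : ℤ) g F := by
  ext z
  have hd : (mapGL ℝ g).val.det = 1 := by
    rw [← Matrix.GeneralLinearGroup.val_det_apply, det_mapGL, Units.val_one]
  have h := UpperHalfPlane.deriv_smul (g := mapGL ℝ g) (by rw [hd]; exact one_pos) z
  rw [ModularForm.SL_slash_apply]
  change F (g • z) * deriv (fun w : ℂ => ((mapGL ℝ g • ofComplex w : ℍ) : ℂ)) z = _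
  rw [h, hd, zpow_neg, Complex.ofReal_one, one_div]
  rfl

theorem pullForm_one (F : ℍ → ℂ) : pullForm 1 F = F := by
  have := pullForm_mk 1 F
  rw [SlashAction.slash_one] at this
  exact this

theorem pullForm_mul (g h : PSL(2, ℤ)) (F : ℍ → ℂ) :
    pullForm (g * h) F = pullForm h (pullForm g F) := by
  induction g using QuotientGroup.induction_on with | _ g
  induction h using QuotientGroup.induction_on with | _ h
  rw [← QuotientGroup.mk_mul, pullForm_mk, pullForm_mk, pullForm_mk, SlashAction.slash_mul]

/-- `Sh_k(Γ)`: the space of one-forms spanned by the `f(z) P(z, 1) dz`, where `f ∈ S_k(Γ)` and `P`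
is homogeneous of degree `k - 2`. A form `F(z) dz` is represented by `F`. -/
def Sh (Γ : Subgroup SL(2, ℤ)) (k : ℕ) : Submodule ℂ (ℍ → ℂ) :=
  Submodule.span ℂ {F | ∃ (f : CuspForm (Γ.map (mapGL ℝ)) k) (P : MvPolynomial (Fin 2) ℂ),
    P.IsHomogeneous (k - 2) ∧ F = fun z : ℍ => f z * MvPolynomial.eval ![(z : ℂ), 1] P}

theorem eval_smul_of_isHomogeneous {n : ℕ} {P : MvPolynomial (Fin 2) ℂ} (hP : P.IsHomogeneous n)
    (c : ℂ) (x : Fin 2 → ℂ) :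
    MvPolynomial.eval (fun i => c * x i) P = c ^ n * MvPolynomial.eval x P := by
  rw [MvPolynomial.eval_eq', MvPolynomial.eval_eq', Finset.mul_sum]
  refine Finset.sum_congr rfl fun d hd => ?_
  have h := hP (MvPolynomial.mem_support_iff.mp hd)
  have h' : ∑ i, d i = n := by
    rw [← h, Finsupp.weight_apply, Finsupp.sum_fintype _ _ (by simp)]
    simp
  simp only [mul_pow, Finset.prod_mul_distrib, Finset.prod_pow_eq_pow_sum, h']
  ring

theorem pullForm_mem_Sh {Γ : Subgroup SL(2, ℤ)} {k : ℕ} (hk : 2 ≤ k) {g : PSL(2, ℤ)}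
    (hg : g ∈ PGamma Γ) : ∀ F ∈ Sh Γ k, pullForm g F ∈ Sh Γ k := by
  obtain ⟨γ, hγ, rfl⟩ := hg
  intro F hF
  induction hF using Submodule.span_induction with
  | zero => simp
  | add F G _ _ hF hG => rw [map_add]; exact add_mem hF hG
  | smul c F _ hF => rw [map_smul]; exact Submodule.smul_mem _ c hF
  | mem F hF =>
    obtain ⟨f, P, hP, rfl⟩ := hF
    let l : Fin 2 → MvPolynomial (Fin 2) ℂ := fun i =>
      MvPolynomial.C (γ i 0 : ℂ) * MvPolynomial.X 0 + MvPolynomial.C (γ i 1 : ℂ) * MvPolynomial.X 1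
    refine Submodule.subset_span ⟨f, MvPolynomial.aeval l P, ?_, ?_⟩
    · have := hP.aeval (n := 1) l fun i =>
        (MvPolynomial.isHomogeneous_C_mul_X _ _).add (MvPolynomial.isHomogeneous_C_mul_X _ _)
      simpa using this
    · ext z
      have h0 : denom (mapGL ℝ γ) z ≠ 0 := denom_ne_zero _ z
      have hden : denom (mapGL ℝ γ) z = (γ 1 0 : ℂ) * z + γ 1 1 := by simp [denom]
      have hf := SlashInvariantForm.slash_action_eqn'' f (Subgroup.mem_map_of_mem (mapGL ℝ) hγ) z
      have hz : ((γ • z : ℍ) : ℂ) = ((γ 0 0 : ℂ) * z + γ 0 1) / denom (mapGL ℝ γ) z := by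
        rw [UpperHalfPlane.coe_specialLinearGroup_apply, hden]; simp
      have hP1 := eval_smul_of_isHomogeneous hP (denom (mapGL ℝ γ) z) ![((γ • z : ℍ) : ℂ), 1]
      have hP2 : MvPolynomial.eval ![(z : ℂ), 1] (MvPolynomial.aeval l P)
          = MvPolynomial.eval (fun i => denom (mapGL ℝ γ) z * ![((γ • z : ℍ) : ℂ), 1] i) P := by
        rw [MvPolynomial.aeval_def, MvPolynomial.eval₂_comp_left]
        rw [← MvPolynomial.eval₂_id]
        congr 1
        · ext; simp
        · ext i
          fin_cases i
          · have : denom (mapGL ℝ γ) z * ((γ • z : ℍ) : ℂ) = (γ 0 0 : ℂ) * z + γ 0 1 := by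
              rw [hz, mul_div_cancel₀ _ h0]
            simpa [l] using this.symm
          · simp [l, hden]
      have hmk := pullForm_mk γ
        (fun z : ℍ => f z * MvPolynomial.eval ![(z : ℂ), 1] P)
      refine (congrFun hmk z).trans ?_
      rw [ModularForm.SL_slash_apply, hP2, hP1]
      change f (mapGL ℝ γ • z) * _ * denom (mapGL ℝ γ) z ^ (-2 : ℤ) = _
      rw [hf, zpow_natCast]
      obtain ⟨m, rfl⟩ := Nat.exists_eq_add_of_le hk
      rw [Nat.add_sub_cancel_left, pow_add, zpow_neg]
      field_simp

/-- A finite family of pairwise distinct weights `k_i ≥ 2`. -/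
structure Weights (ι : Type*) where
  /-- The weights. -/
  wt : ι → ℕ
  two_le : ∀ i, 2 ≤ wt i
  injective : Function.Injective wt

section

variable {ι : Type*}

/-- The direct sum of the spaces `Sh_{k_i}(Γ)` over the (finite) family of weights. -/
abbrev ShSum (Γ : Subgroup SL(2, ℤ)) (k : Weights ι) : Type _ := ∀ i, Sh Γ (k.wt i)

/-- The one-form on `ℍ` defined by an element of the direct sum. -/
noncomputable def toForm [Fintype ι] {Γ : Subgroup SL(2, ℤ)} {k : Weights ι} (η : ShSum Γ k) :
    ℍ → ℂ := ∑ i, (η i : ℍ → ℂ)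

variable (Γ : Subgroup SL(2, ℤ)) (k : Weights ι)

/-- The pullback `g^*` on the direct sum. -/
noncomputable def pullSh (g : PGamma Γ) : ShSum Γ k →ₗ[ℂ] ShSum Γ k :=
  LinearMap.pi fun i => ((pullForm g.1).restrict (pullForm_mem_Sh (k.two_le i) g.2)).comp
    (LinearMap.proj i)

theorem pullSh_one : pullSh Γ k 1 = LinearMap.id := by
  ext η i
  simp [pullSh, LinearMap.restrict_apply, pullForm_one]

theorem pullSh_mul (g h : PGamma Γ) :
    pullSh Γ k (g * h) = pullSh Γ k h ∘ₗ pullSh Γ k g := by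
  ext η i
  simp [pullSh, LinearMap.restrict_apply, pullForm_mul]

variable {Γ k} {V : Type*}

/-- The group `Π` of group-like series in the variables `A_v`, where `(A_v)` is the dual basis of
the basis `(ω_v)` of the space of one-forms. -/
def GroupPi (_ω : Module.Basis V ℂ (ShSum Γ k)) : Type _ := NCSeries.groupLike V

noncomputable instance (ω : Module.Basis V ℂ (ShSum Γ k)) : Group (GroupPi ω) :=
  inferInstanceAs (Group (NCSeries.groupLike V))

/-- The underlying series of a group-like element. -/
def GroupPi.series {ω : Module.Basis V ℂ (ShSum Γ k)} (F : GroupPi ω) : NCSeries V ℂ :=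
  F.1.1

/-- `PΓ` acts on `Π` through the automorphisms of the ring of series induced by the adjoint action
`g_*` on the dual space, `(g_* A)(η) = A(g^* η)`. -/
noncomputable instance (ω : Module.Basis V ℂ (ShSum Γ k)) :
    MulDistribMulAction (PGamma Γ) (GroupPi ω) where
  smul g F := NCSeries.groupLikeSubst ω (pullSh Γ k g) F
  one_smul F := by
    refine Subtype.ext (Units.ext ?_)
    change NCSeries.subst ω (pullSh Γ k 1) _ = _
    rw [pullSh_one, NCSeries.subst_id]
    rfl
  mul_smul g h F := by
    refine Subtype.ext (Units.ext ?_)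
    change NCSeries.subst ω (pullSh Γ k (g * h)) _
      = NCSeries.subst ω (pullSh Γ k g) (NCSeries.subst ω (pullSh Γ k h) _)
    rw [pullSh_mul, NCSeries.subst_subst]
  smul_mul g F G := map_mul (NCSeries.groupLikeSubst ω (pullSh Γ k g)) F G
  smul_one g := map_one (NCSeries.groupLikeSubst ω (pullSh Γ k g))

end

/-! ### Iterated integrals -/

/-- The path from `i` to a point `c` of `ℍ ∪ ℙ¹(ℚ)` along which one-forms are integrated: the
straight segment if `c ∈ ℍ`, and the geodesic ray from `i` to `c` if `c` is a cusp. (For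
`c = x ∈ ℚ` the ray is the image of a vertical one under `w ↦ x - 1/w`.) -/
noncomputable def path : Hbar → ℝ → ℂ
  | Sum.inl z, t => Complex.I + t * ((z : ℂ) - Complex.I)
  | Sum.inr (some x), t => x - 1 / (1 / (x - Complex.I) + t * Complex.I)
  | Sum.inr none, t => Complex.I + t * Complex.I

/-- The parameter interval of `path c`: from `0` to `1` for `c ∈ ℍ`, from `0` to `∞` for a cusp. -/
def pathDomain : Hbar → Set ℝ
  | Sum.inl _ => Set.Ioc 0 1
  | Sum.inr _ => Set.Ioi 0

/-- The pullback of `F(z) dz` to the parameter interval of `path c`. -/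
noncomputable def pathIntegrand (F : ℍ → ℂ) (c : Hbar) (t : ℝ) : ℂ :=
  F (ofComplex (path c t)) * deriv (path c) t

/-- Absolute convergence of the integral of `F(z) dz` from `i` to `c`. -/
def Converges (F : ℍ → ℂ) (c : Hbar) : Prop :=
  MeasureTheory.IntegrableOn (pathIntegrand F c) (pathDomain c)

/-- The integral of `F(z) dz` from `i` to `c`. -/
noncomputable def pathIntegral (F : ℍ → ℂ) (c : Hbar) : ℂ :=
  ∫ t in pathDomain c, pathIntegrand F c t

/-- `∫_a^b F(z) dz`, along the path from `a` to `b` through `i`. For holomorphic `F`, to which this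
is applied, the choice of the path in the simply connected domain `ℍ` plays no role. -/
noncomputable def lineIntegral (F : ℍ → ℂ) (a b : Hbar) : ℂ :=
  pathIntegral F b - pathIntegral F a

/-- The iterated integral
`∫_a^z η_{v₁}(z₁) ∫_a^{z₁} η_{v₂}(z₂) ⋯ ∫_a^{z_{n-1}} η_{vₙ}(zₙ)` of the word `v₁ v₂ ⋯ vₙ`. -/
noncomputable def iteratedIntegral {V : Type*} (η : V → ℍ → ℂ) (a : Hbar) : List V → Hbar → ℂ
  | [], _ => 1
  | v :: w, z => lineIntegral (fun t => η v t * iteratedIntegral η a w (Sum.inl t)) a z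

section

variable {ι : Type*} [Fintype ι] {Γ : Subgroup SL(2, ℤ)} {k : Weights ι} {V : Type*}

/-- `J_a^z(Ω)` for `Ω = ∑_v A_v ω_v`: the coefficient at `A_{v₁} ⋯ A_{vₙ}` is the iterated integral
of `ω_{v₁}, …, ω_{vₙ}` from `a` to `z`. -/
noncomputable def iteratedShimura (ω : Module.Basis V ℂ (ShSum Γ k)) (a z : Hbar) : NCSeries V ℂ :=
  fun w => iteratedIntegral (fun v => toForm (ω v)) a w z

/-- All the integrals occurring in the coefficients of the `J_a^z(Ω)` converge absolutely. -/
def ShimuraConverges (ω : Module.Basis V ℂ (ShSum Γ k)) : Prop :=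
  ∀ (a c : Hbar) (v : V) (w : List V),
    Converges (fun t => toForm (ω v) t * iteratedShimura ω a (Sum.inl t) w) c

end

/-- The cuspidal subset of `H¹(PΓ, N)`: classes whose restriction to the stabilizer in `PΓ` of
every cusp is trivial. -/
def IsCuspidal {Γ : Subgroup SL(2, ℤ)} {N : Type*} [Group N] [MulDistribMulAction (PGamma Γ) N]
    (ζ : NonabCohomology.H1 (PGamma Γ) N) : Prop :=
  ∀ c : OnePoint ℚ, NonabCohomology.H1.res (MulAction.stabilizer (PGamma Γ) c) ζ
    = NonabCohomology.H1.trivial (MulAction.stabilizer (PGamma Γ) c) N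

end ShimuraCocycle

open NonabCohomology ShimuraCocycle

/-! Everything rests on the uniqueness of primitives. A form that is `CuspIntegrable` is holomorphic
and, after any cusp is moved to `i∞`, decays like `(Im z)⁻²` in vertical strips. Its primitives
therefore have limits at all cusps, and `pathIntegral` is such a primitive on all of `Hbar`
(`CuspIntegrable.isCuspPrimitive`). Two such primitives of one form that agree at one point,
possibly a cusp, agree everywhere (`IsCuspPrimitive.eq_of_eq`). No contour is ever deformed.

The class of forms is stable under iteration: a primitive with limits at the cusps is bounded in
strips near each cusp, so multiplying by it preserves the decay
(`IsCuspPrimitive.mul_cuspIntegrable`). Cusp forms decay exponentially at every cusp while the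
polynomial factors grow polynomially, so all of `Sh` lies in this class (`cuspIntegrable_toForm`).
This gives the convergence.

Three identities follow by induction on words, both sides being primitives of the same form with the
same value at the base point: composition `J_b^z J_a^b = J_a^z` (`iteratedSeries_mul`), the shuffle
relations, i.e. group-likeness (`comul_iteratedSeries`), and equivariance `g_* J_a^z = J_{ga}^{gz}`
(`subst_iteratedShimura`).

The rest is formal. The cocycle identity is `J_{ga}^a J_{gha}^{ga} = J_{gha}^a`; changing `a` to `b`
twists the cocycle by `J_b^a`; and with base point a cusp `c` the cocycle is identically `1` on the
stabilizer of `c`, since `J_c^c = 1`. -/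

namespace ShimuraCocycle

open Filter Topology Asymptotics MeasureTheory Set

/-! ### Vertical strips, and primitives extended to the cusps -/

/-- Approach to `i∞` inside the vertical strip `|Re z| ≤ A`. -/
def strip (A : ℝ) : Filter ℍ := atImInfty ⊓ 𝓟 {z | |z.re| ≤ A}

/-- A holomorphic one-form which, after transport of any cusp to `i∞`, is `O((Im z)⁻²)` in vertical
strips. -/
structure CuspIntegrable (F : ℍ → ℂ) : Prop where
  diff : ∀ z : ℍ, DifferentiableAt ℂ (fun w => F (ofComplex w)) z
  decay : ∀ (g : PSL(2, ℤ)) (A : ℝ), pullForm g F =O[strip A] fun z => (z.im ^ 2)⁻¹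

/-- `U` is a primitive of `F(z) dz` on `ℍ`, and its values at the cusps are its limits inside the
transports of vertical strips. -/
structure IsCuspPrimitive (U : Hbar → ℂ) (F : ℍ → ℂ) : Prop where
  deriv : ∀ z : ℍ, HasDerivAt (fun w => U (Sum.inl (ofComplex w))) (F z) z
  lim : ∀ (g : PSL(2, ℤ)) (A : ℝ), Tendsto (fun z : ℍ => U (g • (Sum.inl z : Hbar))) (strip A)
    (𝓝 (U (g • (Sum.inr OnePoint.infty : Hbar))))

theorem smul_inl (g : PSL(2, ℤ)) (z : ℍ) : g • (Sum.inl z : Hbar) = Sum.inl (g • z) := rfl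
theorem smul_inr (g : PSL(2, ℤ)) (c : OnePoint ℚ) : g • (Sum.inr c : Hbar) = Sum.inr (g • c) := rfl

theorem exists_smul_infty_eq (c : OnePoint ℚ) :
    ∃ g : SL(2, ℤ), (g : PSL(2, ℤ)) • (OnePoint.infty : OnePoint ℚ) = c :=
  OnePoint.exists_mem_SL2 ℤ c

theorem mem_strip {A : ℝ} {S : Set ℍ} :
    S ∈ strip A ↔ ∃ Y : ℝ, ∀ z : ℍ, Y ≤ z.im → |z.re| ≤ A → z ∈ S := by
  rw [strip, mem_inf_principal, atImInfty_mem]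
  rfl

theorem tendsto_im_strip (A : ℝ) : Tendsto UpperHalfPlane.im (strip A) atTop :=
  tendsto_comap.mono_left inf_le_left

theorem tendsto_strip {α : Type*} {l : Filter α} {f : α → ℍ} {A : ℝ}
    (h : Tendsto (fun a => (f a).im) l atTop) (hA : ∀ᶠ a in l, |(f a).re| ≤ A) :
    Tendsto f l (strip A) :=
  tendsto_inf.mpr ⟨tendsto_comap_iff.mpr h, tendsto_principal.mpr hA⟩

/-- The ray `t ↦ x + i (y + s t)`. -/
noncomputable def ray (x y s t : ℝ) : ℂ := x + (y + s * t : ℝ) * Complex.I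

theorem ray_im (x y s t : ℝ) : (ray x y s t).im = y + s * t := by simp [ray]
theorem ray_re (x y s t : ℝ) : (ray x y s t).re = x := by simp [ray]

theorem hasDerivAt_ray (x y s t : ℝ) : HasDerivAt (ray x y s) (s * Complex.I) t := by
  have h : HasDerivAt (fun t : ℝ => ((y + s * t : ℝ) : ℂ)) ((s : ℝ) : ℂ) t := by
    have : HasDerivAt (fun t : ℝ => y + s * t) s t := by
      simpa using ((hasDerivAt_id t).const_mul s).const_add y
    exact this.ofReal_comp
  exact (h.mul_const Complex.I).const_add _

theorem coe_ofComplex_of_im_pos {w : ℂ} (h : 0 < w.im) : ((ofComplex w : ℍ) : ℂ) = w := by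
  rw [ofComplex_apply_of_im_pos h]

theorem tendsto_ray (x y : ℝ) {s : ℝ} (hs : 0 < s) :
    Tendsto (fun t => ofComplex (ray x y s t)) atTop (strip |x|) := by
  have h1 : Tendsto (fun t : ℝ => y + s * t) atTop atTop :=
    tendsto_atTop_add_const_left _ _ (tendsto_id.const_mul_atTop hs)
  have h2 : ∀ᶠ t in atTop, 0 < y + s * t := h1.eventually_gt_atTop 0
  refine tendsto_strip (h1.congr' ?_) ?_
  · filter_upwards [h2] with t ht
    rw [← coe_im, coe_ofComplex_of_im_pos (by rwa [ray_im]), ray_im]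
  · filter_upwards [h2] with t ht
    rw [← coe_re, coe_ofComplex_of_im_pos (by rwa [ray_im]), ray_re]

/-- Makes limits at a cusp unique, so that the value of a primitive there is forced by its values on
`ℍ`; width `0` is enough for this. -/
instance strip_neBot : (strip 0).NeBot := by
  have := tendsto_ray 0 1 one_pos
  rw [abs_zero] at this
  exact this.neBot

theorem hasDerivAt_smul (g : PSL(2, ℤ)) (z : ℍ) :
    HasDerivAt (fun w : ℂ => ((g • ofComplex w : ℍ) : ℂ))
      (_root_.deriv (fun w : ℂ => ((g • ofComplex w : ℍ) : ℂ)) z) z := by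
  induction g using QuotientGroup.induction_on with | _ g
  have hd : (Matrix.SpecialLinearGroup.mapGL ℝ g).val.det = 1 := by
    rw [← Matrix.GeneralLinearGroup.val_det_apply, Matrix.SpecialLinearGroup.det_mapGL,
      Units.val_one]
  exact (hasStrictDerivAt_smul (g := Matrix.SpecialLinearGroup.mapGL ℝ g)
    (by rw [hd]; exact one_pos) z).hasDerivAt.differentiableAt.hasDerivAt

/-- Pullback of a primitive. -/
theorem hasDerivAt_comp_smul {H : ℍ → ℂ} {F : ℍ → ℂ}
    (h : ∀ z : ℍ, HasDerivAt (fun w => H (ofComplex w)) (F z) z) (g : PSL(2, ℤ)) (z : ℍ) :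
    HasDerivAt (fun w => H (g • ofComplex w)) (pullForm g F z) z := by
  have h1 : HasDerivAt (fun w => H (ofComplex w)) (F (g • z))
      ((g • ofComplex (z : ℂ) : ℍ) : ℂ) := by
    rw [ofComplex_apply]; exact h (g • z)
  have := h1.comp (z : ℂ) (hasDerivAt_smul g z)
  refine this.congr_of_eventuallyEq (Eventually.of_forall fun w => ?_)
  simp

/-! ### Limits of primitives at `i∞` under quadratic decay -/

section Strip

variable {H f : ℍ → ℂ} (hH : ∀ z : ℍ, HasDerivAt (fun w => H (ofComplex w)) (f z) z)
include hH

theorem hasDerivAt_of_im_pos {w : ℂ} (hw : 0 < w.im) :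
    HasDerivAt (fun w => H (ofComplex w)) (f (ofComplex w)) w := by
  have := hH (ofComplex w)
  rwa [coe_ofComplex_of_im_pos hw] at this

/-- Having a complex primitive makes `f` the derivative of a holomorphic function, so its continuity
need not be assumed. -/
theorem continuousOn_of_hasDerivAt : ContinuousOn (fun w => f (ofComplex w)) {w | 0 < w.im} := by
  have ho : IsOpen {w : ℂ | 0 < w.im} := isOpen_upperHalfPlaneSet
  have hd : DifferentiableOn ℂ (fun w => H (ofComplex w)) {w | 0 < w.im} := fun w hw =>
    (hasDerivAt_of_im_pos hH hw).differentiableAt.differentiableWithinAt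
  refine (hd.deriv ho).continuousOn.congr fun w hw => ?_
  exact (hasDerivAt_of_im_pos hH hw).deriv.symm

theorem hasDerivAt_ray_comp {x y s t : ℝ} (ht : 0 < y + s * t) :
    HasDerivAt (fun t => H (ofComplex (ray x y s t)))
      (f (ofComplex (ray x y s t)) * (s * Complex.I)) t :=
  (hasDerivAt_of_im_pos hH (by rwa [ray_im])).comp t (hasDerivAt_ray x y s t)

variable (hf : ∀ A, f =O[strip A] fun z => (z.im ^ 2)⁻¹)
include hf

theorem integrableOn_ray (x : ℝ) {y s : ℝ} (hy : 0 < y) (hs : 0 < s) :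
    IntegrableOn (fun t => f (ofComplex (ray x y s t)) * (s * Complex.I)) (Ioi 0) := by
  have hc : ContinuousOn (fun t => f (ofComplex (ray x y s t)) * (s * Complex.I)) (Ici 0) := by
    refine ContinuousOn.mul ?_ continuousOn_const
    refine (continuousOn_of_hasDerivAt hH).comp
      (fun t _ => (hasDerivAt_ray x y s t).continuousAt.continuousWithinAt) fun t ht => ?_
    have : 0 ≤ s * t := mul_nonneg hs.le ht
    simp only [mem_ofPred_eq, ray_im]; linarith
  refine ((hc.locallyIntegrableOn measurableSet_Ici).integrableOn_of_isBigO_atTop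
    (g := fun t : ℝ => t ^ (-2 : ℝ)) ?_
    (integrableAtFilter_rpow_atTop_iff.mpr (by norm_num))).mono_set Ioi_subset_Ici_self
  have h1 := (hf |x|).comp_tendsto (tendsto_ray x y hs)
  have h2 : (fun t => f (ofComplex (ray x y s t)) * (s * Complex.I))
      =O[atTop] fun t : ℝ => ((y + s * t) ^ 2)⁻¹ := by
    refine ((isBigO_refl (fun t => f (ofComplex (ray x y s t))) atTop).const_mul_left
      (s * Complex.I)).congr_left (fun t => mul_comm _ _) |>.trans (h1.congr' (by rfl) ?_)
    filter_upwards [eventually_ge_atTop 0] with t ht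
    have : 0 ≤ s * t := mul_nonneg hs.le ht
    simp only [Function.comp]
    rw [← coe_im, coe_ofComplex_of_im_pos (by rw [ray_im]; linarith), ray_im]
  -- The constant comes from `y + s t ≥ s t`.
  refine h2.trans (IsBigO.of_bound (s ^ 2)⁻¹ ?_)
  filter_upwards [eventually_gt_atTop 0] with t ht
  have h3 : 0 < s * t := mul_pos hs ht
  rw [Real.rpow_neg ht.le, norm_inv, norm_inv, ← mul_inv, Real.norm_of_nonneg (by positivity),
    Real.norm_of_nonneg (by positivity), Real.rpow_two]
  gcongr
  nlinarith

/-- Integrability of the derivative gives a limit along the imaginary axis. A point of the strip is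
joined to the axis by a horizontal segment of length at most `A`, on which the derivative is
`O(y⁻²)`, so moving sideways costs `O(A y⁻²)`, which tends to `0`. Hence one `L` serves every width.
-/
theorem exists_tendsto_strip : ∃ L, ∀ A, Tendsto H (strip A) (𝓝 L) := by
  have h1 := tendsto_limUnder_of_hasDerivAt_of_integrableOn_Ioi
    (f := fun t => H (ofComplex (ray 0 1 1 t)))
    (fun t ht => hasDerivAt_ray_comp hH (by have : (0:ℝ) < t := ht; linarith))
    (integrableOn_ray hH hf 0 one_pos one_pos)
  set L := limUnder atTop (fun t => H (ofComplex (ray 0 1 1 t)))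
  refine ⟨L, fun A => ?_⟩
  -- The ray starts at height `1`, so the parameter `z.im - 1` gives the point of the imaginary axis
  -- at the height of `z`.
  have h2 : Tendsto (fun z : ℍ => H (ofComplex (ray 0 1 1 (z.im - 1)))) (strip A) (𝓝 L) :=
    h1.comp (tendsto_atTop_add_const_right _ _ (tendsto_im_strip A))
  obtain ⟨C, hC⟩ := (hf A).bound
  obtain ⟨Y, hY⟩ := mem_strip.mp hC
  have h3 : Tendsto (fun z : ℍ => H z - H (ofComplex (ray 0 1 1 (z.im - 1)))) (strip A) (𝓝 0) := by
    have h4 : Tendsto (fun z : ℍ => C * (z.im ^ 2)⁻¹ * A) (strip A) (𝓝 0) := by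
      have : Tendsto (fun z : ℍ => (z.im ^ 2)⁻¹) (strip A) (𝓝 0) :=
        tendsto_inv_atTop_zero.comp ((tendsto_pow_atTop two_ne_zero).comp (tendsto_im_strip A))
      simpa using (this.const_mul C).mul_const A
    refine squeeze_zero_norm' ?_ h4
    refine mem_strip.mpr ⟨Y, fun z hz hzA => ?_⟩
    have h0 : ∀ w : ℂ, w.im = z.im → |w.re| ≤ A →
        ‖f (ofComplex w)‖ ≤ C * (z.im ^ 2)⁻¹ := by
      intro w hw hwA
      have hwz : (ofComplex w : ℍ).im = z.im := by
        rw [← coe_im, coe_ofComplex_of_im_pos (by rw [hw]; exact z.im_pos), hw]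
      have hwr : (ofComplex w : ℍ).re = w.re := by
        rw [← coe_re, coe_ofComplex_of_im_pos (by rw [hw]; exact z.im_pos)]
      have := hY (ofComplex w) (by rwa [hwz]) (by rwa [hwr])
      simpa [hwz] using this
    have hA : 0 ≤ A := (abs_nonneg _).trans hzA
    have hconv : Convex ℝ {w : ℂ | w.im = z.im ∧ |w.re| ≤ A} := by
      have e : {w : ℂ | w.im = z.im ∧ |w.re| ≤ A}
          = Complex.imLm ⁻¹' {z.im} ∩ Complex.reLm ⁻¹' (Icc (-A) A) := by
        ext w; simp [abs_le]
      rw [e]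
      exact ((convex_singleton _).linear_preimage _).inter ((convex_Icc _ _).linear_preimage _)
    have hr : ray 0 1 1 (z.im - 1) = z.im * Complex.I := by simp [ray]
    have := hconv.norm_image_sub_le_of_norm_hasDerivWithin_le
      (f := fun w => H (ofComplex w)) (f' := fun w => f (ofComplex w)) (C := C * (z.im ^ 2)⁻¹)
      (fun w hw => (hasDerivAt_of_im_pos hH (by rw [hw.1]; exact z.im_pos)).hasDerivWithinAt)
      (fun w hw => h0 w hw.1 hw.2) (x := z.im * Complex.I) (y := z) (by simpa using hA)
      (by simpa using hzA)
    rw [ofComplex_apply] at this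
    change ‖H z - H (ofComplex (ray 0 1 1 (z.im - 1)))‖ ≤ _
    rw [hr]
    refine this.trans ?_
    have h5 : (z : ℂ) - z.im * Complex.I = (z.re : ℂ) := by
      apply Complex.ext <;> simp
    rw [h5, Complex.norm_real]
    exact mul_le_mul_of_nonneg_left hzA ((norm_nonneg _).trans (h0 z rfl hzA))
  simpa using h3.add h2

end Strip

/-! ### Geodesic rays to the cusps -/

/-- The path from `i` to a cusp is the transport of a vertical ray. -/
theorem exists_path_eq_smul_ray (g : SL(2, ℤ)) (c : OnePoint ℚ)
    (hg : (g : PSL(2, ℤ)) • (OnePoint.infty : OnePoint ℚ) = c) :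
    ∃ x y s : ℝ, 0 < y ∧ 0 < s ∧ ∀ t, 0 < y + s * t →
      path (Sum.inr c) t = (((g : PSL(2, ℤ)) • ofComplex (ray x y s t) : ℍ) : ℂ) := by
  rw [mk_smul_rat, OnePoint.smul_infty_eq_ite] at hg
  have hdet : g 0 0 * g 1 1 - g 0 1 * g 1 0 = 1 := by
    rw [← Matrix.det_fin_two]; exact g.det_coe
  have hsmul : ∀ {w : ℂ}, 0 < w.im → (((g : PSL(2, ℤ)) • ofComplex w : ℍ) : ℂ)
      = ((g 0 0 : ℂ) * w + g 0 1) / ((g 1 0 : ℂ) * w + g 1 1) := by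
    intro w hw
    rw [mk_smul_upperHalfPlane, coe_specialLinearGroup_apply, coe_ofComplex_of_im_pos hw]
    simp
  by_cases h : g 1 0 = 0
  · have hc : c = OnePoint.infty := by rw [← hg]; simp [h]
    subst hc
    rw [h, mul_zero, sub_zero] at hdet
    have h00 : g 0 0 = g 1 1 := by
      rcases Int.eq_one_or_neg_one_of_mul_eq_one' hdet with h | h <;> rw [h.1, h.2]
    -- Here `a = d = ±1`, so `g` is the translation by `b d`, and the vertical ray from `i` pulls
    -- back to the one from `i - b d`.
    refine ⟨-(g 0 1 * g 1 1 : ℤ), 1, 1, one_pos, one_pos, fun t ht => ?_⟩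
    have hdet' : (g 1 1 : ℂ) * g 1 1 = 1 := by rw [h00] at hdet; exact_mod_cast hdet
    have hd0 : (g 1 1 : ℂ) ≠ 0 := left_ne_zero_of_mul_eq_one hdet'
    rw [hsmul (by rwa [ray_im]), h, h00, eq_div_iff (by simpa using hd0)]
    simp only [path, ray]
    push_cast
    linear_combination ((g 0 1 : ℂ)) * hdet'
  · have hq : c = ((g 0 0 / g 1 0 : ℚ) : OnePoint ℚ) := by rw [← hg]; simp [h]
    subst hq
    set q : ℝ := g 0 0 / g 1 0 with hq
    have hc0 : (g 1 0 : ℝ) ≠ 0 := by exact_mod_cast h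
    have hcc : (g 1 0 : ℂ) ≠ 0 := by exact_mod_cast h
    -- With `q = a/c` and determinant `1`, `g r = q - 1/(c (c r + d))`. So `r` must solve `c (c r +
    -- d) = 1/(q - i) + t i = (q + i)/(q² + 1) + t i`; the witnesses are the real part, initial
    -- height and speed of this solution.
    refine ⟨(q / (q ^ 2 + 1) - g 1 0 * g 1 1) / g 1 0 ^ 2, 1 / ((q ^ 2 + 1) * g 1 0 ^ 2),
      1 / g 1 0 ^ 2, by positivity, by positivity, fun t ht => ?_⟩
    set r := ray ((q / (q ^ 2 + 1) - g 1 0 * g 1 1) / g 1 0 ^ 2) (1 / ((q ^ 2 + 1) * g 1 0 ^ 2))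
      (1 / g 1 0 ^ 2) t with hr
    have him : 0 < r.im := by rwa [hr, ray_im]
    have hden : (g 1 0 : ℂ) * r + g 1 1 ≠ 0 := by
      intro h0
      have := congrArg Complex.im h0
      simp [h] at this
      exact him.ne' this
    have hqc : (q : ℂ) = g 0 0 / g 1 0 := by rw [hq]; push_cast; rfl
    have hq1 : ((q : ℂ) ^ 2 + 1) ≠ 0 := by
      have : (q ^ 2 + 1 : ℝ) ≠ 0 := by positivity
      exact_mod_cast this
    have hqI : (q : ℂ) - Complex.I ≠ 0 := by
      intro h0
      have := congrArg Complex.im h0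
      simp at this
    have hw : 1 / ((q : ℂ) - Complex.I) + t * Complex.I = g 1 0 * (g 1 0 * r + g 1 1) := by
      have h1 : 1 / ((q : ℂ) - Complex.I) = (q + Complex.I) / (q ^ 2 + 1) := by
        rw [div_eq_div_iff hqI hq1]
        linear_combination Complex.I_sq
      rw [h1, hr, ray]
      push_cast
      field_simp
      ring
    have hp : path (Sum.inr ((g 0 0 / g 1 0 : ℚ) : OnePoint ℚ)) t
        = q - 1 / (1 / ((q : ℂ) - Complex.I) + t * Complex.I) := by
      rw [hqc]; simp only [path]; push_cast; rfl
    rw [hp, hw, hsmul him, hqc]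
    have hdet' : (g 0 0 : ℂ) * g 1 1 - g 0 1 * g 1 0 = 1 := by exact_mod_cast hdet
    field_simp
    linear_combination hdet'

/-! ### Path integrals as primitives -/

theorem exists_primitive {F : ℍ → ℂ}
    (h : ∀ z : ℍ, DifferentiableAt ℂ (fun w => F (ofComplex w)) z) :
    ∃ G : ℍ → ℂ, ∀ z : ℍ, HasDerivAt (fun w => G (ofComplex w)) (F z) z := by
  have ho : IsOpen {w : ℂ | 0 < w.im} := isOpen_upperHalfPlaneSet
  obtain ⟨G, hG⟩ := (convex_halfSpace_im_gt 0).exists_forall_hasDerivWithinAt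
    (f := fun w => F (ofComplex w))
    fun w hw => by
      have := h (ofComplex w)
      rw [coe_ofComplex_of_im_pos hw] at this
      exact this.differentiableWithinAt
  refine ⟨fun z => G z, fun z => ?_⟩
  have h1 := (hG z z.im_pos).hasDerivAt (ho.mem_nhds z.im_pos)
  rw [ofComplex_apply] at h1
  refine h1.congr_of_eventuallyEq ?_
  filter_upwards [ho.mem_nhds z.im_pos] with w hw
  rw [coe_ofComplex_of_im_pos hw]

theorem path_inl_im_pos (z : ℍ) {t : ℝ} (ht : t ∈ Icc (0 : ℝ) 1) : 0 < (path (Sum.inl z) t).im := by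
  have : (path (Sum.inl z) t).im = (1 - t) + t * z.im := by simp [path]; ring
  rw [this]
  rcases eq_or_lt_of_le ht.1 with h | h
  · rw [← h]; norm_num
  · have := mul_pos h z.im_pos
    linarith [ht.2]

theorem hasDerivAt_path_inl (z : ℍ) (t : ℝ) :
    HasDerivAt (path (Sum.inl z)) ((z : ℂ) - Complex.I) t := by
  have := (((hasDerivAt_id t).ofReal_comp).mul_const ((z : ℂ) - Complex.I)).const_add Complex.I
  rw [Complex.ofReal_one, one_mul] at this
  exact this

section Primitive

variable {F G : ℍ → ℂ} (hG : ∀ z : ℍ, HasDerivAt (fun w => G (ofComplex w)) (F z) z)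
include hG

theorem hasDerivAt_comp_path_inl (z : ℍ) {t : ℝ} (ht : t ∈ Icc (0 : ℝ) 1) :
    HasDerivAt (fun t => G (ofComplex (path (Sum.inl z) t))) (pathIntegrand F (Sum.inl z) t) t := by
  have := (hasDerivAt_of_im_pos hG (path_inl_im_pos z ht)).comp t (hasDerivAt_path_inl z t)
  rw [pathIntegrand, (hasDerivAt_path_inl z t).deriv]
  exact this

theorem continuousOn_pathIntegrand_inl (z : ℍ) :
    ContinuousOn (pathIntegrand F (Sum.inl z)) (Icc 0 1) := by
  have e : pathIntegrand F (Sum.inl z) = fun t => F (ofComplex (path (Sum.inl z) t)) *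
      ((z : ℂ) - Complex.I) := by
    ext t; rw [pathIntegrand, (hasDerivAt_path_inl z t).deriv]
  rw [e]
  exact ((continuousOn_of_hasDerivAt hG).comp (fun t _ =>
    (hasDerivAt_path_inl z t).continuousAt.continuousWithinAt)
    fun t ht => path_inl_im_pos z ht).mul continuousOn_const

theorem converges_inl (z : ℍ) : Converges F (Sum.inl z) :=
  ((continuousOn_pathIntegrand_inl hG z).integrableOn_Icc).mono_set Ioc_subset_Icc_self

theorem pathIntegral_inl (z : ℍ) : pathIntegral F (Sum.inl z) = G z - G I := by
  have h := intervalIntegral.integral_eq_sub_of_hasDerivAt_of_le (a := 0) (b := 1)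
    (f := fun t => G (ofComplex (path (Sum.inl z) t))) (f' := pathIntegrand F (Sum.inl z))
    zero_le_one
    (fun t ht => (hasDerivAt_comp_path_inl hG z ht).continuousAt.continuousWithinAt)
    (fun t ht => hasDerivAt_comp_path_inl hG z (Ioo_subset_Icc_self ht))
    ((intervalIntegrable_iff_integrableOn_Ioc_of_le zero_le_one).mpr (converges_inl hG z))
  rw [intervalIntegral.integral_of_le zero_le_one] at h
  have h1 : ofComplex (path (Sum.inl z) 1) = z := by simp [path]
  have h0 : ofComplex (path (Sum.inl z) 0) = I := by simp [path, ← coe_I]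
  rw [h1, h0] at h
  exact h

/-- After transport by `g`, the integral to `c` becomes that of `pullForm g F` up a vertical ray,
where the decay gives convergence and the fundamental theorem on a half-line gives the value. The
limit is written through `pathIntegral`, which sees only `c`, so it is the same for every `g`
carrying `∞` to `c`. -/
theorem converges_inr_and_pathIntegral (hF : CuspIntegrable F) (g : SL(2, ℤ)) (c : OnePoint ℚ)
    (hg : (g : PSL(2, ℤ)) • (OnePoint.infty : OnePoint ℚ) = c) :
    Converges F (Sum.inr c) ∧ ∀ A, Tendsto (fun z : ℍ => G ((g : PSL(2, ℤ)) • z)) (strip A)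
      (𝓝 (pathIntegral F (Sum.inr c) + G I)) := by
  obtain ⟨x, y, s, hy, hs, hp⟩ := exists_path_eq_smul_ray g c hg
  have hH := hasDerivAt_comp_smul hG g
  obtain ⟨L, hL⟩ := exists_tendsto_strip (H := fun z => G ((g : PSL(2, ℤ)) • z)) hH (hF.decay g)
  have hpos : ∀ t ∈ Ici (0 : ℝ), 0 < y + s * t := fun t ht => by
    have : 0 ≤ s * t := mul_nonneg hs.le ht
    linarith
  have hev : ∀ t ∈ Ici (0 : ℝ), ∀ᶠ t' in 𝓝 t, 0 < y + s * t' := fun t ht =>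
    (isOpen_lt continuous_const (by fun_prop)).mem_nhds (hpos t ht)
  have hd : ∀ t ∈ Ici (0 : ℝ), pathIntegrand F (Sum.inr c) t
      = pullForm g F (ofComplex (ray x y s t)) * (s * Complex.I) := by
    intro t ht
    have him : 0 < (ray x y s t).im := by rw [ray_im]; exact hpos t ht
    have h1 := hasDerivAt_smul g (ofComplex (ray x y s t))
    rw [coe_ofComplex_of_im_pos him] at h1
    have h2 := h1.comp t (hasDerivAt_ray x y s t)
    have h3 : HasDerivAt (path (Sum.inr c)) _ t :=
      h2.congr_of_eventuallyEq ((hev t ht).mono fun t' ht' => hp t' ht')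
    rw [pathIntegrand, h3.deriv, hp t (hpos t ht), ofComplex_apply, ← mul_assoc]
    congr 1
    change _ = F _ * _
    rw [coe_ofComplex_of_im_pos him]
  have hint : IntegrableOn (fun t => pullForm g F (ofComplex (ray x y s t)) * (s * Complex.I))
      (Ioi 0) := integrableOn_ray (H := fun z => G ((g : PSL(2, ℤ)) • z)) hH (hF.decay g) x hy hs
  have hc : Converges F (Sum.inr c) :=
    hint.congr_fun (fun t ht => (hd t (Ioi_subset_Ici_self ht)).symm) measurableSet_Ioi
  have hI := integral_Ioi_of_hasDerivAt_of_tendsto'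
    (f := fun t => G ((g : PSL(2, ℤ)) • ofComplex (ray x y s t)))
    (fun t ht => hasDerivAt_ray_comp (H := fun z => G ((g : PSL(2, ℤ)) • z)) hH (hpos t ht)) hint
    ((hL |x|).comp (tendsto_ray x y hs))
  have hval : pathIntegral F (Sum.inr c) = L - G I := by
    -- Every path to a cusp starts at `i`, so the vertical ray starts at the preimage of `i` under
    -- `g`.
    have h0 : (g : PSL(2, ℤ)) • ofComplex (ray x y s 0) = I := by
      have h1 := hp 0 (by simpa using hy)
      have h2 : path (Sum.inr c) 0 = Complex.I := by
        cases c with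
        | infty => simp [path]
        | coe q => simp [path]
      apply UpperHalfPlane.ext
      rw [← h1, h2, coe_I]
    rw [h0] at hI
    rw [← hI]
    exact setIntegral_congr_fun measurableSet_Ioi fun t ht => hd t (Ioi_subset_Ici_self ht)
  refine ⟨hc, fun A => ?_⟩
  rw [hval, sub_add_cancel]
  exact hL A

end Primitive

theorem CuspIntegrable.converges {F : ℍ → ℂ} (hF : CuspIntegrable F) (c : Hbar) :
    Converges F c := by
  obtain ⟨G, hG⟩ := exists_primitive hF.diff
  rcases c with z | c
  · exact converges_inl hG z
  · obtain ⟨g, hg⟩ := exists_smul_infty_eq c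
    exact (converges_inr_and_pathIntegral hG hF g c hg).1

theorem CuspIntegrable.isCuspPrimitive {F : ℍ → ℂ} (hF : CuspIntegrable F) :
    IsCuspPrimitive (pathIntegral F) F := by
  obtain ⟨G, hG⟩ := exists_primitive hF.diff
  constructor
  · intro z
    simp only [pathIntegral_inl hG]
    exact (hG z).sub_const _
  · intro g A
    induction g using QuotientGroup.induction_on with | _ g
    have := ((converges_inr_and_pathIntegral hG hF g _ rfl).2 A).sub_const (G I)
    simpa only [smul_inl, smul_inr, pathIntegral_inl hG, add_sub_cancel_right] using this

/-! ### Calculus of primitives with values at the cusps -/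

namespace IsCuspPrimitive

variable {U U' : Hbar → ℂ} {F F' : ℍ → ℂ}

theorem const (c : ℂ) : IsCuspPrimitive (fun _ => c) 0 :=
  ⟨fun _ => hasDerivAt_const _ _, fun _ _ => tendsto_const_nhds⟩

theorem add (h : IsCuspPrimitive U F) (h' : IsCuspPrimitive U' F') :
    IsCuspPrimitive (fun z => U z + U' z) (fun z => F z + F' z) :=
  ⟨fun z => (h.deriv z).add (h'.deriv z), fun g A => (h.lim g A).add (h'.lim g A)⟩

theorem sub (h : IsCuspPrimitive U F) (h' : IsCuspPrimitive U' F') :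
    IsCuspPrimitive (fun z => U z - U' z) (fun z => F z - F' z) :=
  ⟨fun z => (h.deriv z).sub (h'.deriv z), fun g A => (h.lim g A).sub (h'.lim g A)⟩

theorem const_mul (c : ℂ) (h : IsCuspPrimitive U F) :
    IsCuspPrimitive (fun z => c * U z) (fun z => c * F z) :=
  ⟨fun z => (h.deriv z).const_mul c, fun g A => (h.lim g A).const_mul c⟩

theorem sub_const (h : IsCuspPrimitive U F) (c : ℂ) : IsCuspPrimitive (fun z => U z - c) F :=
  ⟨fun z => (h.deriv z).sub_const c, fun g A => (h.lim g A).sub_const c⟩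

theorem mul (h : IsCuspPrimitive U F) (h' : IsCuspPrimitive U' F') :
    IsCuspPrimitive (fun z => U z * U' z)
      (fun z => F z * U' (Sum.inl z) + U (Sum.inl z) * F' z) :=
  ⟨fun z => by simpa only [ofComplex_apply] using! (h.deriv z).mul (h'.deriv z),
    fun g A => (h.lim g A).mul (h'.lim g A)⟩

/-- The limit condition ranges over all transports, so it survives `γ` by replacing `g` with `γ g`.
-/
theorem smul (h : IsCuspPrimitive U F) (γ : PSL(2, ℤ)) :
    IsCuspPrimitive (fun z => U (γ • z)) (pullForm γ F) := by
  constructor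
  · exact hasDerivAt_comp_smul (H := fun z => U (Sum.inl z)) h.deriv γ
  · intro g A
    simpa only [smul_smul] using h.lim (γ * g) A

/-- Vanishing derivative on the connected `ℍ` makes `U` constant there, and each cusp value is a
limit of interior values. -/
theorem eq_of_zero (h : IsCuspPrimitive U 0) (a b : Hbar) : U a = U b := by
  have ho : IsOpen {w : ℂ | 0 < w.im} := isOpen_upperHalfPlaneSet
  have h1 : ∀ z : ℍ, U (Sum.inl z) = U (Sum.inl I) := by
    intro z
    have hd : ∀ w : ℂ, 0 < w.im → HasDerivAt (fun w => U (Sum.inl (ofComplex w))) 0 w :=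
      fun w hw => hasDerivAt_of_im_pos (H := fun z => U (Sum.inl z)) h.deriv hw
    have := ho.is_const_of_deriv_eq_zero (convex_halfSpace_im_gt 0).isPreconnected
      (f := fun w => U (Sum.inl (ofComplex w)))
      (fun w hw => (hd w hw).differentiableAt.differentiableWithinAt)
      (fun w hw => (hd w hw).deriv) z.im_pos I.im_pos
    simpa only [ofComplex_apply] using this
  have h2 : ∀ z, U z = U (Sum.inl I) := by
    rintro (z | c)
    · exact h1 z
    · obtain ⟨g, rfl⟩ := exists_smul_infty_eq c
      refine tendsto_nhds_unique (h.lim g 0) ?_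
      simp only [smul_inl, h1]
      exact tendsto_const_nhds
  rw [h2 a, h2 b]

/-- A primitive is determined by its value at one point. -/
theorem eq_of_eq (h : IsCuspPrimitive U F) (h' : IsCuspPrimitive U' F) {a : Hbar}
    (ha : U a = U' a) (z : Hbar) : U z = U' z := by
  have := h.sub h'
  simp only [sub_self] at this
  have := this.eq_of_zero z a
  rw [ha, sub_self] at this
  exact sub_eq_zero.mp this

/-- A limit at a cusp makes `U` bounded near it in each strip, so the product keeps the decay of
`F'`. This is what allows integrals to be iterated. -/
theorem mul_cuspIntegrable (h : IsCuspPrimitive U F) (h' : CuspIntegrable F') :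
    CuspIntegrable fun z => F' z * U (Sum.inl z) := by
  constructor
  · exact fun z => (h'.diff z).mul (h.deriv z).differentiableAt
  · intro g A
    have := (h'.decay g A).mul ((h.lim g A).isBigO_one ℝ)
    simp only [mul_one] at this
    refine this.congr_left fun z => ?_
    simp only [pullForm, LinearMap.coe_mk, AddHom.coe_mk, smul_inl]
    ring

theorem lineIntegral_eq (h : IsCuspPrimitive U F) (hF : CuspIntegrable F) (a b : Hbar) :
    lineIntegral F a b = U b - U a := by
  have h1 := hF.isCuspPrimitive.sub h
  simp only [sub_self] at h1
  have := h1.eq_of_zero a b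
  rw [lineIntegral]
  linear_combination -this

end IsCuspPrimitive

theorem CuspIntegrable.lineIntegral {F : ℍ → ℂ} (hF : CuspIntegrable F) (a : Hbar) :
    IsCuspPrimitive (fun z => lineIntegral F a z) F :=
  hF.isCuspPrimitive.sub_const _

end ShimuraCocycle

/-! ### Decay of forms of cusp modular type -/

namespace ShimuraCocycle

open Filter Topology Asymptotics

namespace CuspIntegrable

variable {F F' : ℍ → ℂ}

theorem zero : CuspIntegrable 0 :=
  ⟨fun _ => differentiableAt_const _, fun g A => by rw [map_zero]; exact isBigO_zero _ _⟩

theorem add (h : CuspIntegrable F) (h' : CuspIntegrable F') : CuspIntegrable (F + F') :=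
  ⟨fun z => (h.diff z).add (h'.diff z), fun g A => by
    rw [map_add]; exact (h.decay g A).add (h'.decay g A)⟩

theorem smul (c : ℂ) (h : CuspIntegrable F) : CuspIntegrable (c • F) :=
  ⟨fun z => (h.diff z).const_mul c, fun g A => by
    rw [map_smul]; exact (h.decay g A).const_mul_left c⟩

end CuspIntegrable

theorem one_isBigO_im (A : ℝ) : (fun _ : ℍ => (1 : ℂ)) =O[strip A] UpperHalfPlane.im := by
  refine IsBigO.of_bound 1 ?_
  filter_upwards [(tendsto_im_strip A).eventually_ge_atTop 1] with z hz
  rw [norm_one, one_mul]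
  exact hz.trans (le_abs_self _)

theorem coe_isBigO_im (A : ℝ) : (fun z : ℍ => (z : ℂ)) =O[strip A] UpperHalfPlane.im := by
  refine IsBigO.of_bound (|A| + 1) (mem_strip.mpr ⟨1, fun z hz hA => ?_⟩)
  change ‖(z : ℂ)‖ ≤ (|A| + 1) * ‖z.im‖
  rw [Real.norm_of_nonneg z.im_pos.le]
  have h1 := Complex.norm_le_abs_re_add_abs_im (z : ℂ)
  rw [coe_re, coe_im, abs_of_pos z.im_pos] at h1
  have h2 : |A| ≤ |A| * z.im := le_mul_of_one_le_right (abs_nonneg A) hz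
  linarith [le_abs_self A]

theorem linear_isBigO_im (A : ℝ) (a b : ℂ) :
    (fun z : ℍ => a * z + b) =O[strip A] UpperHalfPlane.im := by
  have := ((coe_isBigO_im A).const_mul_left a).add ((one_isBigO_im A).const_mul_left b)
  simpa using this

theorem exists_eval_isBigO_im_pow {A : ℝ} {x : ℍ → Fin 2 → ℂ}
    (hx : ∀ i, (fun z => x z i) =O[strip A] UpperHalfPlane.im) (P : MvPolynomial (Fin 2) ℂ) :
    ∃ N : ℕ, (fun z => MvPolynomial.eval (x z) P) =O[strip A] fun z => z.im ^ N := by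
  have hmono : ∀ {m n : ℕ}, m ≤ n →
      (fun z : ℍ => z.im ^ m) =O[strip A] fun z : ℍ => z.im ^ n := by
    intro m n h
    refine IsBigO.of_bound 1 ?_
    filter_upwards [(tendsto_im_strip A).eventually_ge_atTop 1] with z hz
    rw [one_mul, norm_pow, norm_pow]
    exact pow_le_pow_right₀ (hz.trans (le_abs_self _)) h
  induction P using MvPolynomial.induction_on with
  | C a =>
    refine ⟨0, ?_⟩
    simp only [MvPolynomial.eval_C, pow_zero]
    exact isBigO_const_const a one_ne_zero _
  | add P Q hP hQ =>
    obtain ⟨m, hm⟩ := hP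
    obtain ⟨n, hn⟩ := hQ
    refine ⟨max m n, ?_⟩
    simp only [map_add]
    exact (hm.trans (hmono (le_max_left m n))).add (hn.trans (hmono (le_max_right m n)))
  | mul_X P i hP =>
    obtain ⟨n, hn⟩ := hP
    refine ⟨n + 1, ?_⟩
    simp only [map_mul, MvPolynomial.eval_X, pow_succ]
    exact hn.mul (hx i)

theorem differentiableAt_eval {x : ℂ → Fin 2 → ℂ} {z : ℂ}
    (hx : ∀ i, DifferentiableAt ℂ (fun w => x w i) z) (P : MvPolynomial (Fin 2) ℂ) :
    DifferentiableAt ℂ (fun w => MvPolynomial.eval (x w) P) z := by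
  induction P using MvPolynomial.induction_on with
  | C a => simp
  | add P Q hP hQ => simpa only [map_add] using! hP.add hQ
  | mul_X P i hP => simpa only [map_mul, MvPolynomial.eval_X] using! hP.mul (hx i)

theorem differentiableAt_coe_ofComplex (z : ℍ) :
    DifferentiableAt ℂ (fun w => ((ofComplex w : ℍ) : ℂ)) z :=
  differentiableAt_id.congr_of_eventuallyEq (eventuallyEq_coe_comp_ofComplex z.im_pos)

-- The slash of `f` by `g` is a cusp form for a conjugate of `Γ`. Finite index makes that conjugate
-- arithmetic, so the decay of cusp forms at `i∞` applies to it; this covers all cusps of `Γ`.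
open ConjAct Pointwise Matrix.SpecialLinearGroup in
theorem cuspForm_slash_exp_decay {Γ : Subgroup SL(2, ℤ)} [Γ.FiniteIndex] {k : ℤ}
    (f : CuspForm (Γ.map (mapGL ℝ)) k) (g : SL(2, ℤ)) :
    ∃ c > 0, SlashAction.map k g (f : ℍ → ℂ) =O[atImInfty] fun z => Real.exp (-c * z.im) := by
  have : ((toConjAct (g : GL (Fin 2) ℝ)⁻¹) • (Γ.map (mapGL ℝ))).IsArithmetic := by
    simpa [(show Rat.castHom ℝ = algebraMap ℚ ℝ by rfl), map_inv, map_mapGL]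
      using! Subgroup.IsArithmetic.conj (Γ.map (mapGL ℝ)) (mapGL ℚ g)⁻¹
  exact CuspFormClass.exp_decay_atImInfty' (CuspForm.translate f g)

-- By homogeneity of `P`, the pullback by `g` with rows `(a, b)`, `(c, d)` is the weight `k` slash
-- of `f` times `P(az + b, cz + d)`: an exponentially small factor times one of polynomial growth in
-- the strip.
open Matrix.SpecialLinearGroup in
theorem cuspIntegrable_cuspForm_mul {Γ : Subgroup SL(2, ℤ)} [Γ.FiniteIndex] {k : ℕ} (hk : 2 ≤ k)
    (f : CuspForm (Γ.map (mapGL ℝ)) k) {P : MvPolynomial (Fin 2) ℂ}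
    (hP : P.IsHomogeneous (k - 2)) :
    CuspIntegrable fun z : ℍ => f z * MvPolynomial.eval ![(z : ℂ), 1] P := by
  constructor
  · intro z
    refine (mdifferentiableAt_iff.mp (f.holo' z)).mul (differentiableAt_eval (fun i => ?_) P)
    fin_cases i
    · exact differentiableAt_coe_ofComplex z
    · exact differentiableAt_const _
  · intro g A
    induction g using QuotientGroup.induction_on with | _ g
    rw [pullForm_mk]
    obtain ⟨c, hc, hf⟩ := cuspForm_slash_exp_decay f g
    obtain ⟨N, hN⟩ := exists_eval_isBigO_im_pow (A := A)
      (x := fun z : ℍ => ![(g 0 0 : ℂ) * z + g 0 1, (g 1 0 : ℂ) * z + g 1 1])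
      (fun i => by fin_cases i <;> exact linear_isBigO_im A _ _) P
    -- The exponent absorbs the growth `(Im z)^N` of the polynomial and leaves the required `(Im
    -- z)⁻²`.
    have hexp : (fun z : ℍ => Real.exp (-c * z.im)) =O[strip A]
        fun z => z.im ^ (-((N : ℝ) + 2)) :=
      ((isLittleO_exp_neg_mul_rpow_atTop hc (-((N : ℝ) + 2))).comp_tendsto
        (tendsto_im_strip A)).isBigO
    refine (((hf.mono inf_le_left).trans hexp).mul hN).congr (fun z => ?_) fun z => ?_
    · have h0 : denom (mapGL ℝ g) z ≠ 0 := denom_ne_zero _ z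
      have hden : denom (mapGL ℝ g) z = (g 1 0 : ℂ) * z + g 1 1 := by simp [denom]
      have hz : ((g • z : ℍ) : ℂ) = ((g 0 0 : ℂ) * z + g 0 1) / denom (mapGL ℝ g) z := by
        rw [UpperHalfPlane.coe_specialLinearGroup_apply, hden]; simp
      have hP1 := eval_smul_of_isHomogeneous hP (denom (mapGL ℝ g) z) ![((g • z : ℍ) : ℂ), 1]
      have hv : ![(g 0 0 : ℂ) * z + g 0 1, (g 1 0 : ℂ) * z + g 1 1]
          = fun i => denom (mapGL ℝ g) z * ![((g • z : ℍ) : ℂ), 1] i := by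
        ext i
        fin_cases i
        · change _ = denom (mapGL ℝ g) z * ((g • z : ℍ) : ℂ)
          rw [hz, mul_div_cancel₀ _ h0]
          rfl
        · simp [hden]
      rw [hv, hP1, ModularForm.SL_slash_apply, ModularForm.SL_slash_apply]
      -- The weight `-k` from `f` and the degree `k - 2` from `P` combine to the automorphy factor
      -- of `dz`; `2 ≤ k` makes the natural subtraction genuine.
      have hpow : denom (mapGL ℝ g) z ^ (-(k : ℤ)) * denom (mapGL ℝ g) z ^ (k - 2)
          = denom (mapGL ℝ g) z ^ (-2 : ℤ) := by
        rw [← zpow_natCast, ← zpow_add₀ h0, Nat.cast_sub hk]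
        congr 1
        push_cast
        ring
      change f (g • z) * denom (mapGL ℝ g) z ^ (-(k : ℤ)) * _
        = f (g • z) * _ * denom (mapGL ℝ g) z ^ (-2 : ℤ)
      rw [← hpow]
      ring
    · rw [Real.rpow_neg z.im_pos.le, Real.rpow_add z.im_pos, Real.rpow_natCast, Real.rpow_two]
      have := z.im_pos.ne'
      field_simp

theorem cuspIntegrable_of_mem_Sh {Γ : Subgroup SL(2, ℤ)} [Γ.FiniteIndex] {k : ℕ} (hk : 2 ≤ k)
    {F : ℍ → ℂ} (hF : F ∈ Sh Γ k) : CuspIntegrable F := by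
  induction hF using Submodule.span_induction with
  | zero => exact .zero
  | add F G _ _ hF hG => exact hF.add hG
  | smul c F _ hF => exact hF.smul c
  | mem F hF =>
    obtain ⟨f, P, hP, rfl⟩ := hF
    exact cuspIntegrable_cuspForm_mul hk f hP

theorem cuspIntegrable_toForm {ι : Type*} [Fintype ι] {Γ : Subgroup SL(2, ℤ)} [Γ.FiniteIndex]
    {k : Weights ι} (η : ShSum Γ k) : CuspIntegrable (toForm η) := by
  classical
  rw [toForm]
  induction (Finset.univ : Finset ι) using Finset.induction_on with
  | empty => exact .zero
  | insert i s hi ih =>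
    rw [Finset.sum_insert hi]
    exact (cuspIntegrable_of_mem_Sh (k.two_le i) (η i).2).add ih

end ShimuraCocycle

/-! ### Iterated integrals: composition, shuffles, equivariance -/

namespace ShimuraCocycle

open NCSeries

theorem IsCuspPrimitive.mul_const {U : Hbar → ℂ} {F : ℍ → ℂ} (h : IsCuspPrimitive U F) (c : ℂ) :
    IsCuspPrimitive (fun z => U z * c) (fun z => F z * c) := by
  simpa only [mul_comm _ c] using h.const_mul c

theorem IsCuspPrimitive.sum {κ : Type*} (s : Finset κ) {U : κ → Hbar → ℂ} {F : κ → ℍ → ℂ}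
    (h : ∀ i ∈ s, IsCuspPrimitive (U i) (F i)) :
    IsCuspPrimitive (fun z => ∑ i ∈ s, U i z) (fun z => ∑ i ∈ s, F i z) := by
  classical
  induction s using Finset.induction_on with
  | empty => exact .const 0
  | insert i s hi ih =>
    simp only [Finset.sum_insert hi]
    exact (h i (Finset.mem_insert_self i s)).add
      (ih fun j hj => h j (Finset.mem_insert_of_mem hj))

/-- The corresponding combination of primitives is a primitive of the combined form, and all of them
vanish at `a`. -/
theorem isLinearMap_lineIntegral {W : Type*} [AddCommGroup W] [Module ℂ W] {f : W → ℍ → ℂ}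
    (hf : ∀ x, CuspIntegrable (f x)) (hlin : ∀ t, IsLinearMap ℂ fun x => f x t) (a z : Hbar) :
    IsLinearMap ℂ fun x => lineIntegral (f x) a z := by
  have h0 : ∀ x, lineIntegral (f x) a a = 0 := fun x => sub_self _
  constructor
  · intro x y
    have h := ((hf x).lineIntegral a).add ((hf y).lineIntegral a)
    simp only [← (hlin _).map_add] at h
    rw [h.lineIntegral_eq (hf (x + y)), h0, h0]
    simp
  · intro c x
    have h := ((hf x).lineIntegral a).const_mul c
    simp only [← smul_eq_mul, ← (hlin _).map_smul] at h
    rw [h.lineIntegral_eq (hf (c • x)), h0]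
    simp

section Iterated

variable {V : Type*} {η : V → ℍ → ℂ}

theorem iteratedIntegral_map {V' : Type*} (η : V' → ℍ → ℂ) (f : V → V') (a : Hbar) (w : List V)
    (z : Hbar) :
    iteratedIntegral η a (w.map f) z = iteratedIntegral (fun v => η (f v)) a w z := by
  induction w generalizing z with
  | nil => rfl
  | cons v w ih => simp only [List.map_cons, iteratedIntegral, ih]

theorem iteratedIntegral_cons_self (η : V → ℍ → ℂ) (a : Hbar) (v : V) (w : List V) :
    iteratedIntegral η a (v :: w) a = 0 := sub_self _

/-- The generating series of the iterated integrals from `a` to `z`. -/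
noncomputable def iteratedSeries (η : V → ℍ → ℂ) (a z : Hbar) : NCSeries V ℂ :=
  fun w => iteratedIntegral η a w z

theorem iteratedSeries_apply (η : V → ℍ → ℂ) (a z : Hbar) (w : List V) :
    iteratedSeries η a z w = iteratedIntegral η a w z := rfl

theorem iteratedSeries_self (η : V → ℍ → ℂ) (a : Hbar) : iteratedSeries η a a = 1 := by
  ext w
  cases w with
  | nil => rfl
  | cons v w => exact iteratedIntegral_cons_self η a v w

variable (hη : ∀ v, CuspIntegrable (η v))
include hη

/-- The inner integral is a primitive with limits at the cusps, hence harmless to the decay of `η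
v`. This holds for a base point in `ℍ` and at a cusp alike. -/
theorem cuspIntegrable_mul_iteratedIntegral (a : Hbar) (v : V) (w : List V) :
    CuspIntegrable fun t => η v t * iteratedIntegral η a w (Sum.inl t) := by
  induction w generalizing v with
  | nil => simpa only [iteratedIntegral, mul_one] using hη v
  | cons v' w ih => exact ((ih v').lineIntegral a).mul_cuspIntegrable (hη v)

theorem isCuspPrimitive_iteratedIntegral (a : Hbar) (v : V) (w : List V) :
    IsCuspPrimitive (iteratedIntegral η a (v :: w))
      fun t => η v t * iteratedIntegral η a w (Sum.inl t) :=
  (cuspIntegrable_mul_iteratedIntegral hη a v w).lineIntegral a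

/-- Composition of paths. -/
theorem iteratedSeries_mul (a b z : Hbar) :
    iteratedSeries η b z * iteratedSeries η a b = iteratedSeries η a z := by
  symm
  ext w
  induction w generalizing z with
  | nil => simp [mul_nil, iteratedSeries_apply, iteratedIntegral]
  | cons v w ih =>
    -- The right-hand side expanded at its first letter `v`: the constant term `1` of the left
    -- factor leaves the fixed integral of the whole word from `a` to `b`, whose derivative is the
    -- `0` below.
    have h : IsCuspPrimitive
        (fun z => (iteratedIntegral η a (v :: w) b) + ∑ i ∈ Finset.range (w.length + 1),
          iteratedIntegral η b (v :: w.take i) z * iteratedIntegral η a (w.drop i) b)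
        (fun t => 0 + ∑ i ∈ Finset.range (w.length + 1),
          η v t * iteratedIntegral η b (w.take i) (Sum.inl t) *
            iteratedIntegral η a (w.drop i) b) :=
      (IsCuspPrimitive.const _).add
        (.sum _ fun i _ => (isCuspPrimitive_iteratedIntegral hη b v _).mul_const _)
    -- The induction hypothesis at the interior point `t` resums the splittings of `w` into the
    -- integral from `a` to `t`.
    have e : (fun t => 0 + ∑ i ∈ Finset.range (w.length + 1),
          η v t * iteratedIntegral η b (w.take i) (Sum.inl t) *
            iteratedIntegral η a (w.drop i) b)
        = fun t => η v t * iteratedIntegral η a w (Sum.inl t) := by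
      ext t
      rw [← iteratedSeries_apply, ih, mul_apply, Finset.mul_sum, zero_add]
      exact Finset.sum_congr rfl fun i _ => mul_assoc _ _ _
    rw [e] at h
    rw [mul_cons, mul_apply]
    have := (isCuspPrimitive_iteratedIntegral hη a v w).eq_of_eq h (a := b)
      (by simp [iteratedIntegral_cons_self]) z
    simpa [iteratedSeries_apply, iteratedIntegral.eq_1, tail_apply] using this

/-- The shuffle relations. -/
theorem comul_iteratedSeries (a z : Hbar) (u v : List V) :
    comul (iteratedSeries η a z) u v
      = iteratedIntegral η a u z * iteratedIntegral η a v z := by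
  have hl : ∀ (x : V) (l : List (List V)),
      IsCuspPrimitive (fun z => (l.map fun w => iteratedIntegral η a (x :: w) z).sum)
        (fun t => η x t * (l.map fun w => iteratedIntegral η a w (Sum.inl t)).sum) := by
    intro x l
    induction l with
    | nil => simpa using! IsCuspPrimitive.const 0
    | cons w l ih =>
      simpa only [List.map_cons, List.sum_cons, mul_add]
        using (isCuspPrimitive_iteratedIntegral hη a x w).add ih
  have key : ∀ (n : ℕ) (u v : List V) (z : Hbar), u.length + v.length = n →
      comul (iteratedSeries η a z) u v
        = iteratedIntegral η a u z * iteratedIntegral η a v z := by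
    intro n
    induction n using Nat.strong_induction_on with
    | _ n ih =>
    intro u v z hn
    cases u with
    | nil => rw [comul_nil_left, iteratedIntegral.eq_1, one_mul, iteratedSeries_apply]
    | cons x u =>
    cases v with
    | nil => rw [comul_nil_right, iteratedIntegral.eq_1, mul_one, iteratedSeries_apply]
    | cons y v =>
      have h1 := (hl x (shuffles u (y :: v))).add (hl y (shuffles (x :: u) v))
      have h2 := (isCuspPrimitive_iteratedIntegral hη a x u).mul
        (isCuspPrimitive_iteratedIntegral hη a y v)
      -- The Leibniz rule for the product of the two integrals matches the recursion of shuffles on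
      -- which word supplies the first letter.
      have e : (fun t => η x t * ((shuffles u (y :: v)).map fun w =>
            iteratedIntegral η a w (Sum.inl t)).sum
          + η y t * ((shuffles (x :: u) v).map fun w => iteratedIntegral η a w (Sum.inl t)).sum)
          = fun t => η x t * iteratedIntegral η a u (Sum.inl t) *
              iteratedIntegral η a (y :: v) (Sum.inl t)
            + iteratedIntegral η a (x :: u) (Sum.inl t) *
              (η y t * iteratedIntegral η a v (Sum.inl t)) := by
        ext t
        have i1 := ih _ (by simp at hn ⊢; omega) u (y :: v) (Sum.inl t) rfl
        have i2 := ih _ (by simp at hn ⊢; omega) (x :: u) v (Sum.inl t) rfl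
        simp only [comul, iteratedSeries_apply] at i1 i2
        rw [i1, i2]
        ring
      rw [e] at h1
      rw [comul_cons]
      -- At `z = a` both sides vanish, all words involved being nonempty.
      exact h1.eq_of_eq h2 (a := a) (by simp [iteratedIntegral_cons_self]) z
  exact key _ u v z rfl

theorem isGroupLike_iteratedSeries (a z : Hbar) : IsGroupLike (iteratedSeries η a z) :=
  ⟨by ext u v; exact comul_iteratedSeries hη a z u v, rfl⟩

/-- Change of variables without comparing paths: the paths through `i` are not carried to one
another by `γ`, but both sides are primitives of the same pulled-back form and vanish at `z = a`. -/
theorem iteratedIntegral_smul {γ : PSL(2, ℤ)} (hγ : ∀ v, CuspIntegrable (pullForm γ (η v)))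
    (a z : Hbar) (w : List V) : iteratedIntegral η (γ • a) w (γ • z)
      = iteratedIntegral (fun v => pullForm γ (η v)) a w z := by
  induction w generalizing z with
  | nil => rfl
  | cons v w ih =>
    have h1 := (isCuspPrimitive_iteratedIntegral hη (γ • a) v w).smul γ
    have h2 := isCuspPrimitive_iteratedIntegral hγ a v w
    have e : pullForm γ (fun t => η v t * iteratedIntegral η (γ • a) w (Sum.inl t))
        = fun t => pullForm γ (η v) t *
          iteratedIntegral (fun v => pullForm γ (η v)) a w (Sum.inl t) := by
      ext t
      rw [← ih]
      simp only [pullForm, LinearMap.coe_mk, AddHom.coe_mk, smul_inl]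
      ring
    rw [e] at h1
    exact h1.eq_of_eq h2 (a := a) (by rw [iteratedIntegral_cons_self, iteratedIntegral_cons_self]) z

end Iterated

/-! ### The cocycle and its class -/

section Shimura

variable {ι : Type*} [Fintype ι] {Γ : Subgroup SL(2, ℤ)} {k : Weights ι} {V : Type*}

theorem toForm_add (η ξ : ShSum Γ k) : toForm (η + ξ) = toForm η + toForm ξ := by
  simp [toForm, Finset.sum_add_distrib]

theorem toForm_smul (c : ℂ) (η : ShSum Γ k) : toForm (c • η) = c • toForm η := by
  simp [toForm, Finset.smul_sum]

theorem toForm_pullSh (g : PGamma Γ) (η : ShSum Γ k) :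
    toForm (pullSh Γ k g η) = pullForm g.1 (toForm η) := by
  simp [toForm, pullSh, LinearMap.restrict_apply]

theorem iteratedShimura_self (ω : Module.Basis V ℂ (ShSum Γ k)) (a : Hbar) :
    iteratedShimura ω a a = 1 := iteratedSeries_self _ a

variable [Γ.FiniteIndex]

theorem isLinearMap_iteratedIntegral (a z : Hbar) (p q : List (ShSum Γ k)) :
    IsLinearMap ℂ fun x => iteratedIntegral toForm a (p ++ x :: q) z := by
  induction p generalizing z with
  | nil =>
    refine isLinearMap_lineIntegral
      (fun x => cuspIntegrable_mul_iteratedIntegral cuspIntegrable_toForm a x q) (fun t => ?_) a z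
    constructor
    · intro x y; simp [toForm_add, add_mul]
    · intro c x; simp [toForm_smul, mul_assoc]
  | cons y p ih =>
    refine isLinearMap_lineIntegral
      (fun x => cuspIntegrable_mul_iteratedIntegral cuspIntegrable_toForm a y (p ++ x :: q))
      (fun t => ?_) a z
    constructor
    · intro x x'; rw [(ih (Sum.inl t)).map_add, mul_add]
    · intro c x; rw [(ih (Sum.inl t)).map_smul, smul_eq_mul, smul_eq_mul, mul_left_comm]

variable (ω : Module.Basis V ℂ (ShSum Γ k))

/-- The basis-free meaning of `J_a^z(Ω)`: as a multilinear functional it sends a list of forms to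
their iterated integral. Both sides are linear in each slot and agree on basis vectors. -/
theorem evalList_iteratedShimura (a z : Hbar) (xs : List (ShSum Γ k)) :
    evalList ω (iteratedShimura ω a z) xs = iteratedIntegral toForm a xs z := by
  refine sub_eq_zero.mp (eq_zero_of_slots ω (φ := fun xs =>
    evalList ω (iteratedShimura ω a z) xs - iteratedIntegral toForm a xs z) ?_ ?_ xs)
  · intro p q
    exact ((evalList_isLinear_slot ω (iteratedShimura ω a z) p q).mk' _
      - (isLinearMap_iteratedIntegral a z p q).mk' _).isLinear
  · intro w
    rw [evalList_basis, iteratedIntegral_map]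
    exact sub_self _

/-- The action evaluates the functional `J_a^z(Ω)` at the forms `g^* ω_v`, and integrating
pulled-back forms from `a` to `z` is integrating the forms themselves from `g a` to `g z`. -/
theorem subst_iteratedShimura (g : PGamma Γ) (a z : Hbar) :
    subst ω (pullSh Γ k g) (iteratedShimura ω a z) = iteratedShimura ω (g • a) (g • z) := by
  ext w
  rw [subst, evalList_iteratedShimura, iteratedIntegral_map]
  have h := iteratedIntegral_smul (η := fun v => toForm (ω v)) (γ := g.1)
    (fun v => cuspIntegrable_toForm _)
    (fun v => by rw [← toForm_pullSh]; exact cuspIntegrable_toForm _) a z w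
  simp only [← toForm_pullSh] at h
  exact h.symm

theorem iteratedShimura_mul (a b z : Hbar) :
    iteratedShimura ω b z * iteratedShimura ω a b = iteratedShimura ω a z :=
  iteratedSeries_mul (fun v => cuspIntegrable_toForm (ω v)) a b z

/-- `J_a^z(Ω)` as an element of `Π`. -/
noncomputable def shimuraPi (a z : Hbar) : GroupPi ω :=
  ⟨⟨iteratedShimura ω a z, iteratedShimura ω z a,
    (iteratedShimura_mul ω z a z).trans (iteratedShimura_self ω z),
    (iteratedShimura_mul ω a z a).trans (iteratedShimura_self ω a)⟩,
    isGroupLike_iteratedSeries (fun v => cuspIntegrable_toForm (ω v)) a z⟩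

theorem shimuraPi_mul (a b z : Hbar) : shimuraPi ω b z * shimuraPi ω a b = shimuraPi ω a z :=
  Subtype.ext (Units.ext (iteratedShimura_mul ω a b z))

theorem shimuraPi_self (a : Hbar) : shimuraPi ω a a = 1 :=
  Subtype.ext (Units.ext (iteratedShimura_self ω a))

theorem shimuraPi_inv (a z : Hbar) : (shimuraPi ω a z)⁻¹ = shimuraPi ω z a :=
  inv_eq_of_mul_eq_one_right (by rw [shimuraPi_mul, shimuraPi_self])

theorem smul_shimuraPi (g : PGamma Γ) (a z : Hbar) :
    g • shimuraPi ω a z = shimuraPi ω (g • a) (g • z) :=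
  Subtype.ext (Units.ext (subst_iteratedShimura ω g a z))

/-- The cocycle `γ ↦ J^a_{γ a}(Ω)`. -/
noncomputable def shimuraCocycle (a : Hbar) : Z1 (PGamma Γ) (GroupPi ω) :=
  -- Equivariance turns the second factor into `J_{gha}^{ga}`, which composes with `J_{ga}^a`.
  ⟨fun γ => shimuraPi ω (γ • a) a, fun g h => by
    rw [smul_shimuraPi, shimuraPi_mul, smul_smul]⟩

/-- The twisting element is `J_b^a`: inserting it gives `J_a^b J_{ga}^a J_{gb}^{ga} = J_{gb}^b`. -/
theorem shimuraCocycle_class_eq (a b : Hbar) :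
    H1.mk (shimuraCocycle ω a) = H1.mk (shimuraCocycle ω b) := by
  refine Quotient.sound ⟨shimuraPi ω b a, fun g => ?_⟩
  change shimuraPi ω (g • b) b = (shimuraPi ω b a)⁻¹ * shimuraPi ω (g • a) a * g • shimuraPi ω b a
  rw [smul_shimuraPi, shimuraPi_inv, shimuraPi_mul, shimuraPi_mul]

/-- As the class is independent of the base point, the cusp `c` itself may be used. Its stabilizer
fixes it, so the cocycle takes the value `J_c^c = 1` there; this is why cusps are admitted as base
points. -/
theorem isCuspidal_shimuraCocycle (a : Hbar) : IsCuspidal (H1.mk (shimuraCocycle ω a)) := by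
  intro c
  rw [shimuraCocycle_class_eq ω a (Sum.inr c)]
  refine congrArg H1.mk (Subtype.ext (funext fun g => ?_))
  change shimuraPi ω (Sum.inr (g.1 • c)) (Sum.inr c) = 1
  rw [MulAction.mem_stabilizer_iff.mp g.2, shimuraPi_self]

end Shimura

end ShimuraCocycle

theorem theorem2p4p1 (Γ : Subgroup SL(2, ℤ)) [Γ.FiniteIndex]
    {ι : Type*} [Fintype ι] (k : Weights ι)
    {V : Type*} (ω : Module.Basis V ℂ (ShSum Γ k)) :
    ShimuraConverges ω ∧
    ∃ u : Hbar → Z1 (PGamma Γ) (GroupPi ω),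
      (∀ (a : Hbar) (γ : PGamma Γ), ((u a).1 γ).series = iteratedShimura ω (γ • a) a) ∧
      (∀ a b : Hbar, H1.mk (u a) = H1.mk (u b)) ∧
      (∀ a : Hbar, IsCuspidal (H1.mk (u a))) :=
  ⟨fun a c v w => (cuspIntegrable_mul_iteratedIntegral
      (fun v => cuspIntegrable_toForm (ω v)) a v w).converges c,
    shimuraCocycle ω, fun _ _ => rfl, shimuraCocycle_class_eq ω, isCuspidal_shimuraCocycle ω⟩
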